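/- **Explicit formula for the NLS flow.** Let $N\in\mathbb{N}$ and let $p_1,\dots,p_N,\ \xi_1^{(0)},\dots,\xi_N^{(0)}\in\mathbb{C}$ be such that $p_i+p_j^*\neq 0$ for all $i,j$ (where $*$ is complex conjugation; in particular $p_i\ne 0$). For $n\in\mathbb{Z}$ and $x,t,z\in\mathbb{R}$ put $$\xi_i=p_ix-\sqrt{-1}\,p_i^2t+\frac{1}{p_i}z+\xi_i^{(0)},\qquad \varphi_i^{(1)}=p_i^ne^{\xi_i},\quad \varphi_i^{(2)}=-1,\quad \psi_i^{(1)}=1,\quad \psi_i^{(2)}=-\Big(-\frac1{p_i^*}\Big)^ne^{\xi_i^*},$$ $$M^{(1)}=\Big(-\frac{\varphi_i^{(1)}\psi_j^{(2)}}{p_i+p_j^*}\Big)_{i,j=1}^N,\qquad M^{(2)}=\Big(\frac{1}{p_i^*+p_j}\Big)_{i,j=1}^N,$$ and, with $\varphi^{(1)},\psi^{(1)}$ written as columns and $\varphi^{(2)},\psi^{(2)}$ as rows, $$\tau_n=\begin{vmatrix}M^{(1)}&I\\-I&M^{(2)}\end{vmatrix},\qquad \sigma_n=\begin{vmatrix}M^{(1)}&I&\varphi^{(1)}\\-I&M^{(2)}&0\\0&\varphi^{(2)}&0\end{vmatrix},\qquad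 \rho_n=\begin{vmatrix}M^{(1)}&I&0\\-I&M^{(2)}&\psi^{(1)}\\\psi^{(2)}&0&0\end{vmatrix},$$ $$F=\tau_0,\qquad G=-\rho_0,\qquad h=-\sigma_{-2}.$$ Then $F$ is a smooth function of $(x,t,z)$ with positive real values, and for every fixed $z\in\mathbb{R}$: 1. $u=2G/F$ is smooth in $(x,t)$ and satisfies the nonlinear Schrödinger equation $$\sqrt{-1}\,\frac{\partial u}{\partial t}+\frac{\partial^2u}{\partial x^2}+\frac12|u|^2u=0 .$$ 2. The curve $$\gamma(x,t)=\Big(\frac{h+h^*}{F},\ \frac{1}{\sqrt{-1}}\,\frac{h-h^*}{F},\ 2\frac{\partial}{\partial z}\log F-x\Big)$$ is real and smooth in $(x,t)$, is parametrized by its arc length $x$, that is $|\partial\gamma/\partial x|=1$, and satisfies the local induction equation $\frac{\partial\gamma}{\partial t}=\frac{\partial\gamma}{\partial x}\times\frac{\partial^2\gamma}{\partial x^2}$. At every point $(x,t)$ where the curvature $\kappa=|\gamma''|$ does not vanish ($'=\partial/\partial x$), put $T=\gamma'$, $\mathsf N=\gamma''/|\gamma''|$, $B=T\times \mathsf N$,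 $\lambda=-\langle B',\mathsf N\rangle$. There the Frenet frame $\Phi=[T,\mathsf N,B]$ lies in $\mathrm{SO}(3)$ and satisfies the Frenet–Serret formula $$\frac{\partial\Phi}{\partial x}=\Phi\begin{bmatrix}0&-\kappa&0\\\kappa&0&-\lambda\\0&\lambda&0\end{bmatrix},$$ and $\gamma$ moves by the binormal flow $\frac{\partial\gamma}{\partial t}=\kappa B$. -/

import Mathlib

open scoped ContDiff Matrix ComplexConjugate

noncomputable section

namespace NLSFlow

/-! Geometry of a curve `c : ℝ → ℝ³` parametrized by its arc length. -/

/-- Euclidean three-space. -/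
abbrev E3 : Type := EuclideanSpace ℝ (Fin 3)

/-- The vector product of Euclidean three-space. -/
def cross (v w : E3) : E3 := WithLp.toLp 2 (crossProduct (WithLp.ofLp v) (WithLp.ofLp w))

/-- The tangent vector `T = c'`. -/
def tangent (c : ℝ → E3) (x : ℝ) : E3 := deriv c x

/-- The curvature `κ = |c''|`. -/
def curvature (c : ℝ → E3) (x : ℝ) : ℝ := ‖deriv (deriv c) x‖

/-- The principal normal `N = c'' / |c''|`; meaningful where the curvature does not vanish. -/
def normal (c : ℝ → E3) (x : ℝ) : E3 := (curvature c x)⁻¹ • deriv (deriv c) x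

/-- The binormal `B = T × N`. -/
def binormal (c : ℝ → E3) (x : ℝ) : E3 := cross (tangent c x) (normal c x)

/-- The torsion `λ = -⟨B', N⟩`. -/
def torsion (c : ℝ → E3) (x : ℝ) : ℝ := -inner ℝ (deriv (binormal c) x) (normal c x)

/-- The Frenet frame `Φ = [T, N, B]`: the matrix with columns `T`, `N`, `B`. -/
def frenetFrame (c : ℝ → E3) (x : ℝ) : Matrix (Fin 3) (Fin 3) ℝ :=
  Matrix.of fun i j => (![tangent c x, normal c x, binormal c x] j) i

/-- The coefficient matrix `L` of the Frenet–Serret formula `Φ' = Φ L`. -/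
def frenetMatrix (c : ℝ → E3) (x : ℝ) : Matrix (Fin 3) (Fin 3) ℝ :=
  !![0, -curvature c x, 0;
     curvature c x, 0, -torsion c x;
     0, torsion c x, 0]

/-! The determinants. The parameters are `p, ξ₀ : Fin N → ℂ`; the variables are the integer `n`
and the real numbers `x`, `t`, `z`. -/

variable {N : ℕ}

/-- `ξ_i = p_i x - √-1 p_i² t + z / p_i + ξ_i⁽⁰⁾`. -/
def xi (p ξ₀ : Fin N → ℂ) (x t z : ℝ) (i : Fin N) : ℂ :=
  p i * x - Complex.I * p i ^ 2 * t + 1 / p i * z + ξ₀ i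

/-- `φ_i⁽¹⁾ = p_i^n exp ξ_i`. -/
def phi1 (p ξ₀ : Fin N → ℂ) (n : ℤ) (x t z : ℝ) (i : Fin N) : ℂ :=
  p i ^ n * Complex.exp (xi p ξ₀ x t z i)

/-- `φ_i⁽²⁾ = -1`. -/
def phi2 (_ : Fin N) : ℂ := -1

/-- `ψ_i⁽¹⁾ = 1`. -/
def psi1 (_ : Fin N) : ℂ := 1

/-- `ψ_i⁽²⁾ = -(-1/p_i*)^n exp ξ_i*`. -/
def psi2 (p ξ₀ : Fin N → ℂ) (n : ℤ) (x t z : ℝ) (i : Fin N) : ℂ :=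
  -((-(1 / conj (p i))) ^ n * Complex.exp (conj (xi p ξ₀ x t z i)))

/-- `m_ij⁽¹⁾ = -φ_i⁽¹⁾ ψ_j⁽²⁾ / (p_i + p_j*)`. -/
def m1 (p ξ₀ : Fin N → ℂ) (n : ℤ) (x t z : ℝ) : Matrix (Fin N) (Fin N) ℂ :=
  Matrix.of fun i j => -(phi1 p ξ₀ n x t z i * psi2 p ξ₀ n x t z j / (p i + conj (p j)))

/-- `m_ij⁽²⁾ = 1 / (p_i* + p_j)`. -/
def m2 (p : Fin N → ℂ) : Matrix (Fin N) (Fin N) ℂ :=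
  Matrix.of fun i j => 1 / (conj (p i) + p j)

/-- The `2N × 2N` matrix with blocks `m⁽¹⁾`, `I`, `-I`, `m⁽²⁾`. -/
def tauMatrix (p ξ₀ : Fin N → ℂ) (n : ℤ) (x t z : ℝ) :
    Matrix (Fin N ⊕ Fin N) (Fin N ⊕ Fin N) ℂ :=
  Matrix.fromBlocks (m1 p ξ₀ n x t z) 1 (-1) (m2 p)

/-- `A` bordered by the column `c`, the row `r` and the corner `0`. -/
def bordered (A : Matrix (Fin N ⊕ Fin N) (Fin N ⊕ Fin N) ℂ) (c r : Fin N ⊕ Fin N → ℂ) :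
    Matrix ((Fin N ⊕ Fin N) ⊕ Unit) ((Fin N ⊕ Fin N) ⊕ Unit) ℂ :=
  Matrix.fromBlocks A (Matrix.of fun i _ => c i) (Matrix.of fun _ j => r j) 0

/-- The determinant `τ_n(x, t; z)`. -/
def tau (p ξ₀ : Fin N → ℂ) (n : ℤ) (x t z : ℝ) : ℂ := (tauMatrix p ξ₀ n x t z).det

/-- The determinant `σ_n(x, t; z)`, with border column `(φ⁽¹⁾, 0)` and border row `(0, φ⁽²⁾)`. -/
def sigma (p ξ₀ : Fin N → ℂ) (n : ℤ) (x t z : ℝ) : ℂ :=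
  (bordered (tauMatrix p ξ₀ n x t z)
    (Sum.elim (phi1 p ξ₀ n x t z) 0) (Sum.elim 0 phi2)).det

/-- The determinant `ρ_n(x, t; z)`, with border column `(0, ψ⁽¹⁾)` and border row `(ψ⁽²⁾, 0)`. -/
def rho (p ξ₀ : Fin N → ℂ) (n : ℤ) (x t z : ℝ) : ℂ :=
  (bordered (tauMatrix p ξ₀ n x t z)
    (Sum.elim 0 psi1) (Sum.elim (psi2 p ξ₀ n x t z) 0)).det

/-- `F = τ_0`. -/
def F (p ξ₀ : Fin N → ℂ) (x t z : ℝ) : ℂ := tau p ξ₀ 0 x t z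

/-- `G = -ρ_0`. -/
def G (p ξ₀ : Fin N → ℂ) (x t z : ℝ) : ℂ := -rho p ξ₀ 0 x t z

/-- `h = -σ_{-2}`. -/
def h (p ξ₀ : Fin N → ℂ) (x t z : ℝ) : ℂ := -sigma p ξ₀ (-2) x t z

/-- `u = 2 G / F`, with `z` an auxiliary parameter. -/
def u (p ξ₀ : Fin N → ℂ) (z x t : ℝ) : ℂ := 2 * (G p ξ₀ x t z / F p ξ₀ x t z)

/-- The three expressions defining the curve, as complex numbers; `z` is an auxiliary parameter. -/
def curveExpr (p ξ₀ : Fin N → ℂ) (z x t : ℝ) : Fin 3 → ℂ :=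
  ![(h p ξ₀ x t z + conj (h p ξ₀ x t z)) / F p ξ₀ x t z,
    1 / Complex.I * ((h p ξ₀ x t z - conj (h p ξ₀ x t z)) / F p ξ₀ x t z),
    2 * deriv (fun s : ℝ => Complex.log (F p ξ₀ x t s)) z - x]

/-- The curve `γ(x, t) ∈ ℝ³`, the point whose coordinates are the (real) numbers `curveExpr`. -/
def curve (p ξ₀ : Fin N → ℂ) (z x t : ℝ) : E3 :=
  WithLp.toLp 2 fun i => (curveExpr p ξ₀ z x t i).re

end NLSFlow

end

/-!
The proof is a Darboux dressing argument carried out on `2 × 2` matrices of moments.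

Put `Λ = diag(p, -p*)`, let `Θ` be the `2N × 2` matrix with columns `(exp ξ, 0)` and `(0, 1)`, and
reverse the signs of the lower block row of the matrix of `τ₀`. The result `M` is Hermitian and
solves the Sylvester equation `Λ M + M Λᴴ = Θ Θᴴ` (`gram_sylvester`). A singular `M` would have
a kernel vector that is an eigenvector of `Λᴴ`, which `p_i + p_j* ≠ 0` excludes
(`gram_det_ne_zero`); no sign of `Re p_i` is assumed, so `M` may be indefinite. As `F` is real and
nonzero for all amplitudes in place of `exp ξ`, and equals `1` when they vanish, it is positive
(`gram_det_pos`).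

All quantities are entries of the moments `Y_{j,k} = (Λ^j Θ)ᴴ M⁻¹ (Λ^k Θ)`: one has
`u = 2 (Y_{0,0})₀₁` (`u_eq`), `∂_z log F = (Y_{-1,-1})₀₀` by Jacobi's formula (`deriv_log_F`), and
`h / F = (Y_{-1,-1})₁₀` (`h_eq_F_mul`). The latter rests on the observation that the matrix of
`τ_{-2}` is a perturbation of that of `τ₀` of rank two (`tauMatrix_neg_two`), so that bordered
determinants at level `-2` become `2 × 2` determinants of moments at level `0`.

The modes satisfy `Θ_x = Λ Θ E` and `Θ_t = -i Λ² Θ E` with `E = diag(1, 0)`, whence closed formulas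
for the derivatives of the moments (`hasEntryDeriv_mom_x`, `hasEntryDeriv_mom_t`), while the
Sylvester equation gives `Y_{j,k+1} + Y_{j+1,k} = Y_{j,0} Y_{0,k}` (`mom_add_mom`). The nonlinear
Schrödinger equation is an immediate combination of these (`schrodinger_mom`). Moreover
`U = 1 - Y_{0,-1}` lies in `SU(2)` and satisfies `U_x = [E, Y_{0,0}] U`, and one finds
`∂_x Y_{-1,-1} = E - Uᴴ E U` and `∂_t Y_{-1,-1} = i Uᴴ [Y_{0,0}, E] U`. The curve consists of
entries of `2 Y_{-1,-1} - x diag(1, -1)`, whose derivatives are traceless Hermitian matrices;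
under the isomorphism of these with `ℝ³` the formulas say that the curve has unit speed
(`norm_tangent_curve`) and moves by the local induction equation (`local_induction_curve`). The
Frenet–Serret formula holds for every smooth unit-speed curve (`frenet_serret`).
-/

noncomputable section

namespace NLSFlow

/-! ### Entrywise calculus of matrix-valued functions -/

section Calculus

variable {l m n : Type*}

/-- Entrywise derivative of a matrix-valued function of a real variable. Working entry by entry
avoids choosing one of the non-canonical norms on matrices, and covers rectangular matrices. -/
def HasEntryDeriv (A : ℝ → Matrix m n ℂ) (A' : Matrix m n ℂ) (s : ℝ) : Prop :=
  ∀ i j, HasDerivAt (fun r => A r i j) (A' i j) s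

/-- Entrywise smoothness of a matrix-valued function. -/
def EntrySmooth {V : Type*} [NormedAddCommGroup V] [NormedSpace ℝ V]
    (A : V → Matrix m n ℂ) : Prop :=
  ∀ i j, ContDiff ℝ ∞ fun v => A v i j

theorem HasEntryDeriv.mul [Fintype m] {A : ℝ → Matrix l m ℂ} {B : ℝ → Matrix m n ℂ}
    {A' : Matrix l m ℂ} {B' : Matrix m n ℂ} {s : ℝ}
    (hA : HasEntryDeriv A A' s) (hB : HasEntryDeriv B B' s) :
    HasEntryDeriv (fun r => A r * B r) (A' * B s + A s * B') s := by
  intro i j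
  simp only [Matrix.mul_apply, Matrix.add_apply, ← Finset.sum_add_distrib]
  exact HasDerivAt.fun_sum fun k _ => (hA i k).mul (hB k j)

theorem HasEntryDeriv.conjTranspose {A : ℝ → Matrix m n ℂ} {A' : Matrix m n ℂ} {s : ℝ}
    (hA : HasEntryDeriv A A' s) : HasEntryDeriv (fun r => (A r)ᴴ) A'ᴴ s :=
  fun i j => (hA j i).star

/-- Jacobi's formula for the derivative of a determinant. -/
theorem HasEntryDeriv.det [Fintype n] [DecidableEq n] {A : ℝ → Matrix n n ℂ}
    {A' : Matrix n n ℂ} {s : ℝ} (hA : HasEntryDeriv A A' s) :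
    HasDerivAt (fun r => (A r).det) (((A s).adjugate * A').trace) s := by
  have key : ((A s).adjugate * A').trace =
      ∑ j, ((A s).updateCol j fun i => A' i j).det := by
    simp only [Matrix.trace, Matrix.diag_apply]
    refine Finset.sum_congr rfl fun j _ => ?_
    rw [← Matrix.cramer_apply, Matrix.cramer_eq_adjugate_mulVec]
    rfl
  rw [key]
  simp only [Matrix.det_apply]
  rw [Finset.sum_comm]
  refine HasDerivAt.fun_sum fun σ _ => ?_
  rw [← Finset.smul_sum]
  refine HasDerivAt.const_smul (Equiv.Perm.sign σ) ?_
  refine (HasDerivAt.fun_finsetProd (u := Finset.univ)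
    (f := fun i r => A r (σ i) i) fun i _ => hA (σ i) i).congr_deriv ?_
  refine Finset.sum_congr rfl fun j _ => ?_
  rw [← Finset.mul_prod_erase _ _ (Finset.mem_univ j), smul_eq_mul, mul_comm]
  congr 1
  · simp
  · refine Finset.prod_congr rfl fun i hi => ?_
    rw [Matrix.updateCol_ne (Finset.ne_of_mem_erase hi)]

variable {V : Type*} [NormedAddCommGroup V] [NormedSpace ℝ V]

theorem EntrySmooth.mul [Fintype m] {A : V → Matrix l m ℂ} {B : V → Matrix m n ℂ}
    (hA : EntrySmooth A) (hB : EntrySmooth B) : EntrySmooth fun v => A v * B v := by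
  intro i j
  simp only [Matrix.mul_apply]
  exact ContDiff.sum fun k _ => (hA i k).mul (hB k j)

theorem EntrySmooth.conjTranspose {A : V → Matrix m n ℂ} (hA : EntrySmooth A) :
    EntrySmooth fun v => (A v)ᴴ :=
  fun i j => (Complex.conjCLE.contDiff (n := ∞)).comp (hA j i)

theorem EntrySmooth.det [Fintype n] [DecidableEq n] {A : V → Matrix n n ℂ} (hA : EntrySmooth A) :
    ContDiff ℝ ∞ fun v => (A v).det := by
  simp only [Matrix.det_apply]
  exact ContDiff.sum fun σ _ => (contDiff_prod fun i _ => hA (σ i) i).const_smul _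

theorem EntrySmooth.inv [Fintype n] [DecidableEq n] {A : V → Matrix n n ℂ} (hA : EntrySmooth A)
    (h0 : ∀ v, (A v).det ≠ 0) : EntrySmooth fun v => (A v)⁻¹ := by
  intro i j
  simp only [Matrix.inv_def, Ring.inverse_eq_inv', Matrix.smul_apply, smul_eq_mul,
    Matrix.adjugate_apply]
  refine (hA.det.inv h0).mul (EntrySmooth.det fun k l => ?_)
  by_cases hk : k = j
  · subst hk
    simpa using contDiff_const
  · simpa [Matrix.updateRow_ne hk] using hA k l

theorem EntrySmooth.hasEntryDeriv {A : ℝ → Matrix m n ℂ} (hA : EntrySmooth A) (s : ℝ) :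
    HasEntryDeriv A (Matrix.of fun i j => deriv (fun r => A r i j) s) s :=
  fun i j => ((hA i j).differentiable (by simp) s).hasDerivAt

theorem HasEntryDeriv.inv [Fintype n] [DecidableEq n] {A : ℝ → Matrix n n ℂ}
    {A' : Matrix n n ℂ} {s : ℝ} (hA : HasEntryDeriv A A' s) (hs : EntrySmooth A)
    (h0 : ∀ r, (A r).det ≠ 0) :
    HasEntryDeriv (fun r => (A r)⁻¹) (-((A s)⁻¹ * A' * (A s)⁻¹)) s := by
  have h1 := (hs.inv h0).hasEntryDeriv s
  set D : Matrix n n ℂ := Matrix.of fun i j => deriv (fun r => (A r)⁻¹ i j) s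
  have hu : ∀ r, IsUnit (A r).det := fun r => (h0 r).isUnit
  have h2 : D * A s + (A s)⁻¹ * A' = 0 := by
    ext i j
    have h3 := h1.mul hA i j
    simp only [Matrix.nonsing_inv_mul _ (hu _)] at h3
    exact h3.unique (hasDerivAt_const s _)
  have h4 : D = -((A s)⁻¹ * A' * (A s)⁻¹) := by
    rw [← Matrix.mul_nonsing_inv_cancel_right (A s) D (hu s), eq_neg_of_add_eq_zero_left h2,
      Matrix.neg_mul]
  rwa [h4] at h1

end Calculus

/-! ### The moments of a Gram matrix satisfying a Sylvester equation -/

section Moments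

variable {ι : Type*} [Fintype ι] [DecidableEq ι]

/-- The `2 × 2` matrix of moments `Θ_jᴴ M⁻¹ Θ_k`. -/
def moment (M : Matrix ι ι ℂ) (Θ : ℤ → Matrix ι (Fin 2) ℂ) (j k : ℤ) : Matrix (Fin 2) (Fin 2) ℂ :=
  (Θ j)ᴴ * M⁻¹ * Θ k

theorem moment_conjTranspose {M : Matrix ι ι ℂ} (hM : M.IsHermitian)
    (Θ : ℤ → Matrix ι (Fin 2) ℂ) (j k : ℤ) : (moment M Θ j k)ᴴ = moment M Θ k j := by
  simp [moment, Matrix.conjTranspose_mul, Matrix.conjTranspose_nonsing_inv, hM.eq,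
    Matrix.mul_assoc]

/-- The Sylvester equation turns a shift of the indices into a product of moments. -/
theorem moment_add_moment {M Λ : Matrix ι ι ℂ} {Θ : ℤ → Matrix ι (Fin 2) ℂ}
    (hM : IsUnit M.det) (hΛ : ∀ k, Λ * Θ k = Θ (k + 1)) (hS : Λ * M + M * Λᴴ = Θ 0 * (Θ 0)ᴴ)
    (j k : ℤ) :
    moment M Θ j (k + 1) + moment M Θ (j + 1) k = moment M Θ j 0 * moment M Θ 0 k := by
  have h1 : M⁻¹ * Λ + Λᴴ * M⁻¹ = M⁻¹ * (Θ 0 * (Θ 0)ᴴ) * M⁻¹ := by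
    rw [← hS, Matrix.mul_add, Matrix.add_mul, ← Matrix.mul_assoc, ← Matrix.mul_assoc,
      Matrix.mul_nonsing_inv_cancel_right _ _ hM, Matrix.nonsing_inv_mul _ hM, Matrix.one_mul]
  have h2 := congrArg (fun K => (Θ j)ᴴ * K * Θ k) h1
  simp only [Matrix.mul_add, Matrix.add_mul] at h2
  simpa only [moment, ← hΛ, Matrix.conjTranspose_mul, Matrix.mul_assoc] using h2

/-- The derivative of the moments, for arbitrary variations `Θ'` of the modes and `M'` of the
Gram matrix. -/
theorem hasEntryDeriv_moment {M : ℝ → Matrix ι ι ℂ} {Θ : ℝ → ℤ → Matrix ι (Fin 2) ℂ}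
    {M' : Matrix ι ι ℂ} {Θ' : ℤ → Matrix ι (Fin 2) ℂ} {s : ℝ}
    (hMs : EntrySmooth M) (h0 : ∀ r, (M r).det ≠ 0)
    (hM : HasEntryDeriv M M' s) (hΘ : ∀ k, HasEntryDeriv (fun r => Θ r k) (Θ' k) s) (j k : ℤ) :
    HasEntryDeriv (fun r => moment (M r) (Θ r) j k)
      ((Θ' j)ᴴ * (M s)⁻¹ * Θ s k + (Θ s j)ᴴ * (M s)⁻¹ * Θ' k
        - (Θ s j)ᴴ * (M s)⁻¹ * M' * (M s)⁻¹ * Θ s k) s := by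
  have h := ((hΘ j).conjTranspose.mul (hM.inv hMs h0)).mul (hΘ k)
  refine fun a b => (h a b).congr_deriv (congrArg (fun K : Matrix (Fin 2) (Fin 2) ℂ => K a b) ?_)
  simp only [Matrix.add_mul, Matrix.mul_neg, Matrix.neg_mul, Matrix.mul_assoc]
  abel

end Moments

/-! ### Algebra of the determinants -/

section Border

variable {ι : Type*} [Fintype ι] [DecidableEq ι] {N : ℕ}

/-- A determinant bordered with corner `0` is a difference of a rank-one perturbation and the
unperturbed determinant; the inner matrix may be singular. -/
theorem det_bordered (A : Matrix (Fin N ⊕ Fin N) (Fin N ⊕ Fin N) ℂ) (c r : Fin N ⊕ Fin N → ℂ) :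
    (bordered A c r).det = (A - Matrix.vecMulVec c r).det - A.det := by
  have h1 : A - Matrix.vecMulVec c r =
      A - (Matrix.of fun i (_ : Unit) => c i) * (Matrix.of fun (_ : Unit) j => r j) := by
    ext i j; simp [Matrix.mul_apply, Matrix.vecMulVec_apply]
  have h2 := Matrix.det_fromBlocks_one₂₂ A (Matrix.of fun i (_ : Unit) => c i)
    (Matrix.of fun (_ : Unit) j => r j)
  have h3 := Matrix.det_fromBlocks_zero₂₁ A (Matrix.of fun i (_ : Unit) => c i)
    (1 : Matrix Unit Unit ℂ)
  rw [h1, ← h2, ← mul_one A.det, ← Matrix.det_one (n := Unit), ← h3, eq_sub_iff_add_eq]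
  have h4 : bordered A c r = (bordered A c r).updateRow (Sum.inr ()) (Sum.elim r 0) := by
    ext (i | i) (j | j) <;> simp [bordered, Matrix.updateRow_apply]
  have h5 : Matrix.fromBlocks A (Matrix.of fun i (_ : Unit) => c i) 0 1 =
      (bordered A c r).updateRow (Sum.inr ()) (Sum.elim 0 1) := by
    ext (i | i) (j | j) <;> simp [bordered, Matrix.updateRow_apply]
  have h6 : Matrix.fromBlocks A (Matrix.of fun i (_ : Unit) => c i)
      (Matrix.of fun (_ : Unit) j => r j) 1 =
      (bordered A c r).updateRow (Sum.inr ())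
        (Sum.elim r (0 : Unit → ℂ) + Sum.elim (0 : Fin N ⊕ Fin N → ℂ) (1 : Unit → ℂ)) := by
    ext (i | i) (j | j) <;> simp [bordered, Matrix.updateRow_apply]
  rw [h6, h5, Matrix.det_updateRow_add, ← h4]

theorem det_add_vecMulVec (A : Matrix ι ι ℂ) (hA : IsUnit A.det) (c r : ι → ℂ) :
    (A + Matrix.vecMulVec c r).det = A.det * (1 + r ⬝ᵥ A⁻¹ *ᵥ c) := by
  have h := Matrix.det_add_mul (Matrix.of fun i (_ : Unit) => c i)
    (Matrix.of fun (_ : Unit) j => r j) hA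
  have h1 : (Matrix.of fun i (_ : Unit) => c i) * (Matrix.of fun (_ : Unit) j => r j)
      = Matrix.vecMulVec c r := by
    ext i j; simp [Matrix.mul_apply, Matrix.vecMulVec_apply]
  rw [h1] at h
  rw [h, Matrix.det_unique (n := Unit), Matrix.mul_assoc]
  simp [Matrix.mul_apply, dotProduct, Matrix.mulVec]

theorem det_add_two_vecMulVec (A : Matrix ι ι ℂ) (hA : IsUnit A.det) (c₁ r₁ c₂ r₂ : ι → ℂ) :
    (A + Matrix.vecMulVec c₁ r₁ + Matrix.vecMulVec c₂ r₂).det =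
      A.det * ((1 + r₁ ⬝ᵥ A⁻¹ *ᵥ c₁) * (1 + r₂ ⬝ᵥ A⁻¹ *ᵥ c₂)
        - (r₁ ⬝ᵥ A⁻¹ *ᵥ c₂) * (r₂ ⬝ᵥ A⁻¹ *ᵥ c₁)) := by
  have h := Matrix.det_add_mul (Matrix.of fun i (k : Fin 2) => ![c₁ i, c₂ i] k)
    (Matrix.of fun (k : Fin 2) j => ![r₁ j, r₂ j] k) hA
  have h1 : (Matrix.of fun i (k : Fin 2) => ![c₁ i, c₂ i] k) *
      (Matrix.of fun (k : Fin 2) j => ![r₁ j, r₂ j] k)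
      = Matrix.vecMulVec c₁ r₁ + Matrix.vecMulVec c₂ r₂ := by
    ext i j; simp [Matrix.mul_apply, Matrix.vecMulVec_apply]
  rw [h1, ← add_assoc] at h
  rw [h, Matrix.det_fin_two, Matrix.mul_assoc]
  simp [Matrix.mul_apply, dotProduct, Matrix.mulVec]

end Border

/-! ### The modes and the Gram matrix of a soliton solution -/

section Modes

variable {N : ℕ}

/-- The poles `p_i` and `-p_i*` of the dressing matrix, as a diagonal matrix. -/
def poles (p : Fin N → ℂ) : Matrix (Fin N ⊕ Fin N) (Fin N ⊕ Fin N) ℂ :=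
  Matrix.diagonal (Sum.elim p fun i => -conj (p i))

/-- The modes `Λ^k Θ`, where `Λ` is the matrix of poles and the two columns of `Θ` are
`(e, 0)` and `(0, 1)`, for an arbitrary vector `e` of amplitudes. -/
def modes (p e : Fin N → ℂ) (k : ℤ) : Matrix (Fin N ⊕ Fin N) (Fin 2) ℂ :=
  Matrix.of (Sum.elim (fun i => ![p i ^ k * e i, 0]) fun i => ![0, (-conj (p i)) ^ k])

/-- The Hermitian form of the matrix of `τ₀`: the signs of its lower block row are reversed, and
the exponentials are replaced by arbitrary amplitudes `e`. -/
def gram (p e : Fin N → ℂ) : Matrix (Fin N ⊕ Fin N) (Fin N ⊕ Fin N) ℂ :=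
  Matrix.fromBlocks (Matrix.of fun i j => e i * conj (e j) / (p i + conj (p j))) 1 1 (-(m2 p))

/-- The projection onto the first coordinate of `ℂ²`. -/
def proj : Matrix (Fin 2) (Fin 2) ℂ := !![1, 0; 0, 0]

/-- The sign matrix relating the Gram matrix to the matrix of `τ₀`. -/
def blockSign : Matrix (Fin N ⊕ Fin N) (Fin N ⊕ Fin N) ℂ := Matrix.fromBlocks 1 0 0 (-1)

theorem blockSign_mul_blockSign :
    (blockSign : Matrix (Fin N ⊕ Fin N) (Fin N ⊕ Fin N) ℂ) * blockSign = 1 := by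
  simp [blockSign, Matrix.fromBlocks_multiply]

theorem det_blockSign :
    (blockSign : Matrix (Fin N ⊕ Fin N) (Fin N ⊕ Fin N) ℂ).det = (-1) ^ N := by
  simp [blockSign, Matrix.det_neg]

variable {p : Fin N → ℂ}

theorem pole_ne_zero (hp : ∀ i j, p i + conj (p j) ≠ 0) (i : Fin N) : p i ≠ 0 := by
  intro h
  exact hp i i (by simp [h])

theorem poles_mul_modes (hp : ∀ i j, p i + conj (p j) ≠ 0) (e : Fin N → ℂ) (k : ℤ) :
    poles p * modes p e k = modes p e (k + 1) := by
  ext (i | i) j <;> fin_cases j <;>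
    simp [poles, modes, Matrix.diagonal_mul, zpow_add_one₀, pole_ne_zero hp i] <;> ring

theorem gram_isHermitian (p e : Fin N → ℂ) : (gram p e).IsHermitian := by
  ext (i | i) (j | j) <;>
    simp [gram, m2, Matrix.conjTranspose_apply, Matrix.one_apply, eq_comm, add_comm, mul_comm]

theorem gram_sylvester (hp : ∀ i j, p i + conj (p j) ≠ 0) (e : Fin N → ℂ) :
    poles p * gram p e + gram p e * (poles p)ᴴ = modes p e 0 * (modes p e 0)ᴴ := by
  have hp' : ∀ i j, conj (p i) + p j ≠ 0 := fun i j => by rw [add_comm]; exact hp j i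
  ext i j
  rw [Matrix.add_apply, poles, Matrix.diagonal_conjTranspose, Matrix.diagonal_mul,
    Matrix.mul_diagonal, Matrix.mul_apply, Fin.sum_univ_two]
  obtain i | i := i <;> obtain j | j := j
  · have := hp i j
    simp [gram, modes]
    field_simp
  · by_cases h : i = j
    · subst h
      simp [gram, modes]
    · simp [gram, modes, h]
  · by_cases h : i = j
    · subst h
      simp [gram, modes]
    · simp [gram, modes, h]
  · have := hp' i j
    simp [gram, modes, m2]
    field_simp

open scoped ComplexOrder in
/-- The kernel of a singular Hermitian solution of the Sylvester equation is invariant under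
`Λᴴ`, hence contains an eigenvector of it. -/
theorem exists_eigenvector_of_det_eq_zero {ι κ : Type*} [Fintype ι] [DecidableEq ι] [Fintype κ]
    {M Λ : Matrix ι ι ℂ} {Θ : Matrix ι κ ℂ} (hM : M.IsHermitian)
    (hS : Λ * M + M * Λᴴ = Θ * Θᴴ) (h0 : M.det = 0) :
    ∃ v : ι → ℂ, v ≠ 0 ∧ M *ᵥ v = 0 ∧ ∃ μ : ℂ, Λᴴ *ᵥ v = μ • v := by
  have inv : ∀ v ∈ LinearMap.ker M.mulVecLin, Λᴴ.mulVecLin v ∈ LinearMap.ker M.mulVecLin := by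
    intro v hv
    replace hv : M *ᵥ v = 0 := hv
    have hv' : star v ᵥ* M = 0 := by
      have := congrArg star hv
      rwa [Matrix.star_mulVec, hM.eq, star_zero] at this
    -- pairing the Sylvester equation with `v` on both sides gives `‖Θᴴ v‖² = 0`
    have hΘ : Θᴴ *ᵥ v = 0 := by
      rw [← dotProduct_star_self_eq_zero, Matrix.star_mulVec,
        Matrix.conjTranspose_conjTranspose, ← Matrix.dotProduct_mulVec,
        Matrix.mulVec_mulVec, ← hS, Matrix.add_mulVec, ← Matrix.mulVec_mulVec, hv,
        Matrix.mulVec_zero, zero_add, ← Matrix.mulVec_mulVec, Matrix.dotProduct_mulVec, hv',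
        zero_dotProduct]
    have h1 := congrArg (fun K => K *ᵥ v) hS
    simp only [Matrix.add_mulVec, ← Matrix.mulVec_mulVec, hv, hΘ, Matrix.mulVec_zero,
      zero_add] at h1
    exact h1
  obtain ⟨v₀, hv₀, hMv₀⟩ := Matrix.exists_mulVec_eq_zero_iff.mpr h0
  have : Nontrivial (LinearMap.ker M.mulVecLin) :=
    ⟨⟨⟨v₀, hMv₀⟩, 0, fun h => hv₀ (congrArg Subtype.val h)⟩⟩
  obtain ⟨μ, hμ⟩ := Module.End.exists_eigenvalue (Λᴴ.mulVecLin.restrict inv)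
  obtain ⟨⟨v, hv⟩, hv1⟩ := hμ.exists_hasEigenvector
  refine ⟨v, fun h => hv1.2 (Subtype.ext h), hv, μ, ?_⟩
  exact congrArg Subtype.val hv1.apply_eq_smul

/-- The Gram matrix is nonsingular although it is indefinite: a kernel vector that is an
eigenvector of `Λᴴ` is supported on one of the two blocks, as the spectra `p_i*` and `-p_j` of the
blocks are disjoint, and the identity blocks of the Gram matrix then force it to vanish. -/
theorem gram_det_ne_zero (hp : ∀ i j, p i + conj (p j) ≠ 0) (e : Fin N → ℂ) :
    (gram p e).det ≠ 0 := by
  intro h0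
  obtain ⟨v, hv, hMv, μ, hμ⟩ :=
    exists_eigenvector_of_det_eq_zero (gram_isHermitian p e) (gram_sylvester hp e) h0
  have hl : ∀ i, conj (p i) * v (Sum.inl i) = μ * v (Sum.inl i) := fun i => by
    simpa [poles, Matrix.diagonal_conjTranspose, Matrix.mulVec_diagonal] using
      congrFun hμ (Sum.inl i)
  have hr : ∀ i, -p i * v (Sum.inr i) = μ * v (Sum.inr i) := fun i => by
    simpa [poles, Matrix.diagonal_conjTranspose, Matrix.mulVec_diagonal] using
      congrFun hμ (Sum.inr i)
  have hsplit : v = Sum.elim (v ∘ Sum.inl) (v ∘ Sum.inr) := by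
    ext (i | i) <;> rfl
  rw [hsplit, gram, Matrix.fromBlocks_mulVec] at hMv
  have h1 := congrArg (fun w => w ∘ Sum.inl) hMv
  have h2 := congrArg (fun w => w ∘ Sum.inr) hMv
  simp only [Sum.elim_comp_inl, Sum.elim_comp_inr, Matrix.one_mulVec, Matrix.neg_mulVec] at h1 h2
  by_cases hz : v ∘ Sum.inl = 0
  · rw [hz, Matrix.mulVec_zero, zero_add] at h1
    refine hv ?_
    rw [hsplit, hz, h1]
    ext (i | i) <;> rfl
  · obtain ⟨i, hi⟩ := Function.ne_iff.mp hz
    have hz' : v ∘ Sum.inr = 0 := by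
      ext j
      by_contra hj
      have e1 := mul_right_cancel₀ hi (hl i)
      have e2 := mul_right_cancel₀ hj (hr j)
      exact hp j i (by rw [e1, ← e2]; ring)
    rw [hz', Matrix.mulVec_zero, neg_zero, add_zero] at h2
    exact hz h2

theorem det_fromBlocks_zero_one_neg_one (B : Matrix (Fin N) (Fin N) ℂ) :
    (Matrix.fromBlocks (0 : Matrix (Fin N) (Fin N) ℂ) 1 (-1) B).det = 1 := by
  have h : Matrix.fromBlocks (0 : Matrix (Fin N) (Fin N) ℂ) 1 (-1) B =
      Matrix.fromBlocks (1 : Matrix (Fin N) (Fin N) ℂ) 1 0 (1 : Matrix (Fin N) (Fin N) ℂ) *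
        Matrix.fromBlocks 1 0 (-1) 1 * Matrix.fromBlocks 1 (1 - B) 0 1 := by
    simp [Matrix.fromBlocks_multiply]
  rw [h, Matrix.det_mul, Matrix.det_mul]
  simp

theorem EntrySmooth.gram {V : Type*} [NormedAddCommGroup V] [NormedSpace ℝ V]
    {e : V → Fin N → ℂ} (he : ∀ i, ContDiff ℝ ∞ fun v => e v i) (p : Fin N → ℂ) :
    EntrySmooth fun v => gram p (e v) := by
  rintro (i | i) (j | j)
  · simp only [NLSFlow.gram, Matrix.fromBlocks_apply₁₁, Matrix.of_apply]
    exact ((he i).mul ((Complex.conjCLE.contDiff (n := ∞)).comp (he j))).div_const _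
  all_goals exact contDiff_const

theorem EntrySmooth.modes {V : Type*} [NormedAddCommGroup V] [NormedSpace ℝ V]
    {e : V → Fin N → ℂ} (he : ∀ i, ContDiff ℝ ∞ fun v => e v i) (p : Fin N → ℂ) (k : ℤ) :
    EntrySmooth fun v => modes p (e v) k := by
  rintro (i | i) j <;> fin_cases j
  · exact contDiff_const.mul (he i)
  all_goals exact contDiff_const

/-- The signed determinant of the Gram matrix is positive: it is real and does not vanish along
the segment that joins the amplitudes `0` and `e`, and it is `1` at the amplitudes `0`. -/
theorem gram_det_pos (hp : ∀ i j, p i + conj (p j) ≠ 0) (e : Fin N → ℂ) :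
    0 < ((-1) ^ N * (gram p e).det).re ∧ ((-1) ^ N * (gram p e).det).im = 0 := by
  have him : ∀ e, ((-1) ^ N * (gram p e).det).im = 0 := fun e => by
    rw [← Complex.conj_eq_iff_im, map_mul, map_pow, map_neg, map_one, starRingEnd_apply,
      ← Matrix.det_conjTranspose, (gram_isHermitian p e).eq]
  refine ⟨?_, him e⟩
  set f : ℝ → ℝ := fun r => ((-1) ^ N * (gram p fun i => r * e i).det).re
  have hf : Continuous f := by
    have h1 : EntrySmooth fun r : ℝ => gram p fun i => (r : ℂ) * e i :=
      EntrySmooth.gram (fun i => (Complex.ofRealCLM.contDiff (n := ∞)).mul contDiff_const) p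
    exact Complex.continuous_re.comp (continuous_const.mul h1.det.continuous)
  have hf0 : f 0 = 1 := by
    have : blockSign * (gram p fun i => (0 : ℂ) * e i) = Matrix.fromBlocks 0 1 (-1) (m2 p) := by
      simp [blockSign, gram, Matrix.fromBlocks_multiply]
      rfl
    simp only [f, Complex.ofReal_zero]
    rw [← det_blockSign, ← Matrix.det_mul, this, det_fromBlocks_zero_one_neg_one, Complex.one_re]
  have hne : ∀ r, f r ≠ 0 := fun r hr =>
    mul_ne_zero (pow_ne_zero N (neg_ne_zero.mpr one_ne_zero)) (gram_det_ne_zero hp _)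
      (Complex.ext hr (him _))
  have hf1 : ((-1) ^ N * (gram p e).det).re = f 1 := by simp [f]
  rw [hf1]
  by_contra hle
  obtain ⟨r, -, hr⟩ := intermediate_value_Icc' zero_le_one hf.continuousOn
    (show (0 : ℝ) ∈ Set.Icc (f 1) (f 0) from ⟨not_lt.mp hle, by simp [hf0]⟩)
  exact hne r hr

theorem hasEntryDeriv_modes {e : ℝ → Fin N → ℂ} {e' : Fin N → ℂ} {s : ℝ}
    (he : ∀ i, HasDerivAt (fun r => e r i) (e' i) s) (p : Fin N → ℂ) (k : ℤ) :
    HasEntryDeriv (fun r => modes p (e r) k)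
      (Matrix.of (Sum.elim (fun i => ![p i ^ k * e' i, 0]) 0)) s := by
  rintro (i | i) j <;> fin_cases j
  · exact (he i).const_mul _
  · exact hasDerivAt_const _ _
  · exact hasDerivAt_const _ _
  · exact hasDerivAt_const _ _

theorem hasEntryDeriv_gram {e : ℝ → Fin N → ℂ} {e' : Fin N → ℂ} {s : ℝ}
    (he : ∀ i, HasDerivAt (fun r => e r i) (e' i) s) (p : Fin N → ℂ) :
    HasEntryDeriv (fun r => gram p (e r))
      (Matrix.fromBlocks (Matrix.of fun i j =>
        (e' i * conj (e s j) + e s i * conj (e' j)) / (p i + conj (p j))) 0 0 0) s := by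
  rintro (i | i) (j | j)
  · exact ((he i).mul (he j).star).div_const _
  all_goals exact hasDerivAt_const _ _

end Modes

/-! ### Evolution of the moments -/

section Evolution

variable {N : ℕ}

/-- The amplitudes `exp ξ_i`. -/
def amp (p ξ₀ : Fin N → ℂ) (x t z : ℝ) (i : Fin N) : ℂ := Complex.exp (xi p ξ₀ x t z i)

/-- The moments of the modes with amplitudes `exp ξ_i`. -/
def mom (p ξ₀ : Fin N → ℂ) (j k : ℤ) (x t z : ℝ) : Matrix (Fin 2) (Fin 2) ℂ :=
  moment (gram p (amp p ξ₀ x t z)) (modes p (amp p ξ₀ x t z)) j k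

theorem contDiff_amp (p ξ₀ : Fin N → ℂ) (i : Fin N) :
    ContDiff ℝ ∞ fun q : ℝ × ℝ × ℝ => amp p ξ₀ q.1 q.2.1 q.2.2 i := by
  have h1 : ContDiff ℝ ∞ fun q : ℝ × ℝ × ℝ => (q.1 : ℂ) :=
    (Complex.ofRealCLM.contDiff (n := ∞)).comp contDiff_fst
  have h2 : ContDiff ℝ ∞ fun q : ℝ × ℝ × ℝ => (q.2.1 : ℂ) :=
    (Complex.ofRealCLM.contDiff (n := ∞)).comp (contDiff_fst.comp contDiff_snd)
  have h3 : ContDiff ℝ ∞ fun q : ℝ × ℝ × ℝ => (q.2.2 : ℂ) :=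
    (Complex.ofRealCLM.contDiff (n := ∞)).comp (contDiff_snd.comp contDiff_snd)
  exact ((((contDiff_const.mul h1).sub (contDiff_const.mul h2)).add
    (contDiff_const.mul h3)).add contDiff_const).cexp

theorem hasDerivAt_amp_x (p ξ₀ : Fin N → ℂ) (x t z : ℝ) (i : Fin N) :
    HasDerivAt (fun y => amp p ξ₀ y t z i) (p i * amp p ξ₀ x t z i) x := by
  have h : HasDerivAt (fun y : ℝ => xi p ξ₀ y t z i) (p i * 1) x :=
    (((((hasDerivAt_id x).ofReal_comp).const_mul (p i)).sub_const _).add_const _).add_const _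
  exact h.cexp.congr_deriv (by rw [amp]; ring)

theorem hasDerivAt_amp_t (p ξ₀ : Fin N → ℂ) (x t z : ℝ) (i : Fin N) :
    HasDerivAt (fun s => amp p ξ₀ x s z i) (-Complex.I * p i ^ 2 * amp p ξ₀ x t z i) t := by
  have h : HasDerivAt (fun s : ℝ => xi p ξ₀ x s z i) (-(Complex.I * p i ^ 2 * 1)) t :=
    (((((hasDerivAt_id t).ofReal_comp).const_mul (Complex.I * p i ^ 2)).const_sub _).add_const
      _).add_const _
  exact h.cexp.congr_deriv (by rw [amp]; ring)

theorem hasDerivAt_amp_z (p ξ₀ : Fin N → ℂ) (x t z : ℝ) (i : Fin N) :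
    HasDerivAt (fun s => amp p ξ₀ x t s i) ((p i)⁻¹ * amp p ξ₀ x t z i) z := by
  have h : HasDerivAt (fun s : ℝ => xi p ξ₀ x t s i) (1 / p i * 1) z :=
    ((((hasDerivAt_id z).ofReal_comp).const_mul (1 / p i)).const_add _).add_const _
  exact h.cexp.congr_deriv (by rw [amp]; ring)

theorem contDiff_amp_comp (p ξ₀ : Fin N → ℂ) {V : Type*} [NormedAddCommGroup V]
    [NormedSpace ℝ V] {f : V → ℝ × ℝ × ℝ} (hf : ContDiff ℝ ∞ f) (i : Fin N) :
    ContDiff ℝ ∞ fun v => amp p ξ₀ (f v).1 (f v).2.1 (f v).2.2 i :=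
  (contDiff_amp p ξ₀ i).comp hf

variable {p : Fin N → ℂ}

theorem mom_entrySmooth (hp : ∀ i j, p i + conj (p j) ≠ 0) (ξ₀ : Fin N → ℂ) (j k : ℤ) (z : ℝ) :
    EntrySmooth fun q : ℝ × ℝ => mom p ξ₀ j k q.1 q.2 z := by
  have he := contDiff_amp_comp p ξ₀ (f := fun q : ℝ × ℝ => (q.1, q.2, z))
    (contDiff_fst.prodMk (contDiff_snd.prodMk contDiff_const))
  exact ((EntrySmooth.modes he p j).conjTranspose.mul
    ((EntrySmooth.gram he p).inv fun _ => gram_det_ne_zero hp _)).mul (EntrySmooth.modes he p k)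

theorem mom_conjTranspose (p ξ₀ : Fin N → ℂ) (j k : ℤ) (x t z : ℝ) :
    (mom p ξ₀ j k x t z)ᴴ = mom p ξ₀ k j x t z :=
  moment_conjTranspose (gram_isHermitian _ _) _ _ _

theorem conj_mom_apply (p ξ₀ : Fin N → ℂ) (j k : ℤ) (x t z : ℝ) (a b : Fin 2) :
    conj (mom p ξ₀ j k x t z a b) = mom p ξ₀ k j x t z b a := by
  rw [← mom_conjTranspose p ξ₀ j k]; rfl

theorem mom_add_mom (hp : ∀ i j, p i + conj (p j) ≠ 0) (ξ₀ : Fin N → ℂ) (j k : ℤ) (x t z : ℝ) :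
    mom p ξ₀ j (k + 1) x t z + mom p ξ₀ (j + 1) k x t z =
      mom p ξ₀ j 0 x t z * mom p ξ₀ 0 k x t z :=
  moment_add_moment (gram_det_ne_zero hp _).isUnit (poles_mul_modes hp _)
    (gram_sylvester hp _) j k

theorem hasEntryDeriv_mom_x (hp : ∀ i j, p i + conj (p j) ≠ 0) (ξ₀ : Fin N → ℂ) (j k : ℤ)
    (x t z : ℝ) :
    HasEntryDeriv (fun y => mom p ξ₀ j k y t z)
      (proj * mom p ξ₀ (j + 1) k x t z + mom p ξ₀ j (k + 1) x t z * proj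
        - mom p ξ₀ j 0 x t z * proj * mom p ξ₀ 0 k x t z) x := by
  have he := contDiff_amp_comp p ξ₀ (f := fun y : ℝ => (y, t, z))
    (contDiff_id.prodMk contDiff_const)
  have hd := fun i => hasDerivAt_amp_x p ξ₀ x t z i
  have h := hasEntryDeriv_moment (EntrySmooth.gram (e := fun y => amp p ξ₀ y t z) he p)
    (fun _ => gram_det_ne_zero hp _) (hasEntryDeriv_gram (e := fun y => amp p ξ₀ y t z) hd p)
    (hasEntryDeriv_modes (e := fun y => amp p ξ₀ y t z) hd p) j k
  have e1 : ∀ k : ℤ, (Matrix.of (Sum.elim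
      (fun i => ![p i ^ k * (p i * amp p ξ₀ x t z i), 0]) 0) : Matrix (Fin N ⊕ Fin N) (Fin 2) ℂ) =
      modes p (amp p ξ₀ x t z) (k + 1) * proj := fun k => by
    ext (i | i) b <;> fin_cases b <;>
      simp [modes, proj, Matrix.mul_apply, zpow_add_one₀ (pole_ne_zero hp _)]
    ring
  have e2 : Matrix.fromBlocks (Matrix.of fun i j => (p i * amp p ξ₀ x t z i *
      conj (amp p ξ₀ x t z j) + amp p ξ₀ x t z i * conj (p j * amp p ξ₀ x t z j)) /
      (p i + conj (p j))) 0 0 0 =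
      modes p (amp p ξ₀ x t z) 0 * proj * (modes p (amp p ξ₀ x t z) 0)ᴴ := by
    ext (i | i) (j | j)
    · have := hp i j
      simp [modes, proj, Matrix.mul_apply, Fin.sum_univ_two]
      field_simp
    all_goals simp [modes, proj, Matrix.mul_apply, Fin.sum_univ_two]
  have e3 : (proj)ᴴ = proj := by
    ext a b; fin_cases a <;> fin_cases b <;> simp [proj]
  refine fun a b => (h a b).congr_deriv (congrArg (fun K : Matrix (Fin 2) (Fin 2) ℂ => K a b) ?_)
  simp only [e1, e2, mom, moment, Matrix.conjTranspose_mul, e3, Matrix.mul_assoc]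

theorem hasEntryDeriv_mom_t (hp : ∀ i j, p i + conj (p j) ≠ 0) (ξ₀ : Fin N → ℂ) (j k : ℤ)
    (x t z : ℝ) :
    HasEntryDeriv (fun s => mom p ξ₀ j k x s z)
      (Complex.I • (proj * mom p ξ₀ (j + 2) k x t z - mom p ξ₀ j (k + 2) x t z * proj
        + mom p ξ₀ j 1 x t z * proj * mom p ξ₀ 0 k x t z
        - mom p ξ₀ j 0 x t z * proj * mom p ξ₀ 1 k x t z)) t := by
  have he := contDiff_amp_comp p ξ₀ (f := fun s : ℝ => (x, s, z))
    (contDiff_const.prodMk (contDiff_id.prodMk contDiff_const))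
  have hd := fun i => hasDerivAt_amp_t p ξ₀ x t z i
  have h := hasEntryDeriv_moment (EntrySmooth.gram (e := fun s => amp p ξ₀ x s z) he p)
    (fun _ => gram_det_ne_zero hp _) (hasEntryDeriv_gram (e := fun s => amp p ξ₀ x s z) hd p)
    (hasEntryDeriv_modes (e := fun s => amp p ξ₀ x s z) hd p) j k
  have e1 : ∀ k : ℤ, (Matrix.of (Sum.elim
      (fun i => ![p i ^ k * (-Complex.I * p i ^ 2 * amp p ξ₀ x t z i), 0]) 0) :
        Matrix (Fin N ⊕ Fin N) (Fin 2) ℂ) =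
      -Complex.I • (modes p (amp p ξ₀ x t z) (k + 2) * proj) := fun k => by
    ext (i | i) b <;> fin_cases b <;>
      simp [modes, proj, Matrix.mul_apply, zpow_add₀ (pole_ne_zero hp _)]
    ring
  have e2 : Matrix.fromBlocks (Matrix.of fun i j => (-Complex.I * p i ^ 2 * amp p ξ₀ x t z i *
      conj (amp p ξ₀ x t z j) +
      amp p ξ₀ x t z i * conj (-Complex.I * p j ^ 2 * amp p ξ₀ x t z j)) /
      (p i + conj (p j))) 0 0 0 =
      -Complex.I • (modes p (amp p ξ₀ x t z) 1 * proj * (modes p (amp p ξ₀ x t z) 0)ᴴ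
        - modes p (amp p ξ₀ x t z) 0 * proj * (modes p (amp p ξ₀ x t z) 1)ᴴ) := by
    ext (i | i) (j | j)
    · have := hp i j
      simp [modes, proj, Matrix.mul_apply, Fin.sum_univ_two]
      field_simp
      ring
    all_goals simp [modes, proj, Matrix.mul_apply, Fin.sum_univ_two]
  have e3 : (proj)ᴴ = proj := by
    ext a b; fin_cases a <;> fin_cases b <;> simp [proj]
  have e4 : star Complex.I = -Complex.I := Complex.conj_I
  refine fun a b => (h a b).congr_deriv (congrArg (fun K : Matrix (Fin 2) (Fin 2) ℂ => K a b) ?_)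
  simp only [e1, e2, mom, moment, Matrix.conjTranspose_mul, Matrix.conjTranspose_smul, e3, e4,
    Matrix.mul_assoc, star_neg, Matrix.smul_mul, Matrix.mul_smul, Matrix.mul_sub, Matrix.sub_mul]
  module

/-- The logarithmic `z`-derivative of the Gram determinant is a moment, by Jacobi's formula. -/
theorem hasDerivAt_gram_det_z (hp : ∀ i j, p i + conj (p j) ≠ 0) (ξ₀ : Fin N → ℂ) (x t z : ℝ) :
    HasDerivAt (fun s => (gram p (amp p ξ₀ x t s)).det)
      ((gram p (amp p ξ₀ x t z)).det * mom p ξ₀ (-1) (-1) x t z 0 0) z := by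
  have hd := fun i => hasDerivAt_amp_z p ξ₀ x t z i
  refine (hasEntryDeriv_gram hd p).det.congr_deriv ?_
  have e2 : Matrix.fromBlocks (Matrix.of fun i j => ((p i)⁻¹ * amp p ξ₀ x t z i *
      conj (amp p ξ₀ x t z j) +
      amp p ξ₀ x t z i * conj ((p j)⁻¹ * amp p ξ₀ x t z j)) /
      (p i + conj (p j))) 0 0 0 =
      modes p (amp p ξ₀ x t z) (-1) * proj * (modes p (amp p ξ₀ x t z) (-1))ᴴ := by
    ext (i | i) (j | j)
    · have h1 := hp i j
      have h2 := pole_ne_zero hp i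
      have h3 : conj (p j) ≠ 0 := by simpa using pole_ne_zero hp j
      simp [modes, proj, Matrix.mul_apply, Fin.sum_univ_two]
      field_simp
      ring
    all_goals simp [modes, proj, Matrix.mul_apply, Fin.sum_univ_two]
  have h0 : (gram p (amp p ξ₀ x t z)).adjugate =
      (gram p (amp p ξ₀ x t z)).det • (gram p (amp p ξ₀ x t z))⁻¹ := by
    rw [Matrix.inv_def, Ring.inverse_eq_inv', smul_smul,
      mul_inv_cancel₀ (gram_det_ne_zero hp _), one_smul]
  rw [e2, h0, Matrix.smul_mul, Matrix.trace_smul, smul_eq_mul]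
  congr 1
  rw [← Matrix.mul_assoc, Matrix.trace_mul_comm, ← Matrix.mul_assoc, ← Matrix.mul_assoc]
  change (moment _ _ (-1) (-1) * proj).trace = _
  simp [Matrix.trace, proj, Matrix.mul_apply, mom]

end Evolution

/-! ### The functions `F`, `u` and `h / F` as moments -/

section Dictionary

variable {N : ℕ}

theorem tauMatrix_zero (p ξ₀ : Fin N → ℂ) (x t z : ℝ) :
    tauMatrix p ξ₀ 0 x t z = blockSign * gram p (amp p ξ₀ x t z) := by
  ext (i | i) (j | j) <;>
    simp [tauMatrix, blockSign, gram, Matrix.fromBlocks_multiply, m1, phi1, psi2, amp,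
      Complex.exp_conj]
  ring

theorem F_eq (p ξ₀ : Fin N → ℂ) (x t z : ℝ) :
    F p ξ₀ x t z = (-1) ^ N * (gram p (amp p ξ₀ x t z)).det := by
  rw [F, tau, tauMatrix_zero, Matrix.det_mul, det_blockSign]

theorem contDiff_F (p ξ₀ : Fin N → ℂ) :
    ContDiff ℝ ∞ fun q : ℝ × ℝ × ℝ => F p ξ₀ q.1 q.2.1 q.2.2 := by
  simp only [F_eq]
  exact contDiff_const.mul (EntrySmooth.gram
    (e := fun q : ℝ × ℝ × ℝ => amp p ξ₀ q.1 q.2.1 q.2.2) (contDiff_amp p ξ₀) p).det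

variable {p : Fin N → ℂ}

theorem F_pos (hp : ∀ i j, p i + conj (p j) ≠ 0) (ξ₀ : Fin N → ℂ) (x t z : ℝ) :
    0 < (F p ξ₀ x t z).re ∧ (F p ξ₀ x t z).im = 0 := by
  rw [F_eq]
  exact gram_det_pos hp _

theorem F_ne_zero (hp : ∀ i j, p i + conj (p j) ≠ 0) (ξ₀ : Fin N → ℂ) (x t z : ℝ) :
    F p ξ₀ x t z ≠ 0 := fun h => by
  have := (F_pos hp ξ₀ x t z).1
  rw [h] at this
  exact lt_irrefl _ this

theorem deriv_log_F (hp : ∀ i j, p i + conj (p j) ≠ 0) (ξ₀ : Fin N → ℂ) (x t z : ℝ) :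
    deriv (fun s : ℝ => Complex.log (F p ξ₀ x t s)) z = mom p ξ₀ (-1) (-1) x t z 0 0 := by
  have h : HasDerivAt (fun s => F p ξ₀ x t s)
      (F p ξ₀ x t z * mom p ξ₀ (-1) (-1) x t z 0 0) z := by
    simp only [F_eq, mul_assoc]
    exact (hasDerivAt_gram_det_z hp ξ₀ x t z).const_mul _
  rw [(h.clog_real (Or.inl (F_pos hp ξ₀ x t z).1)).deriv,
    mul_div_cancel_left₀ _ (F_ne_zero hp ξ₀ x t z)]

theorem moment_apply {ι : Type*} [Fintype ι] [DecidableEq ι] (M : Matrix ι ι ℂ)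
    (Θ : ℤ → Matrix ι (Fin 2) ℂ) (j k : ℤ) (a b : Fin 2) :
    moment M Θ j k a b = star ((Θ j)ᵀ a) ⬝ᵥ M⁻¹ *ᵥ (Θ k)ᵀ b := by
  rw [moment, Matrix.mul_assoc, Matrix.mul_apply, dotProduct]
  refine Finset.sum_congr rfl fun i _ => ?_
  rw [Matrix.mul_apply]
  rfl

theorem tauMatrix_zero_inv (p ξ₀ : Fin N → ℂ) (x t z : ℝ) :
    (tauMatrix p ξ₀ 0 x t z)⁻¹ = (gram p (amp p ξ₀ x t z))⁻¹ * blockSign := by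
  rw [tauMatrix_zero, Matrix.mul_inv_rev, Matrix.inv_eq_right_inv blockSign_mul_blockSign]

theorem blockSign_mulVec_modes_zero (p e : Fin N → ℂ) (k : ℤ) :
    blockSign *ᵥ (modes p e k)ᵀ 0 = (modes p e k)ᵀ 0 := by
  have h : (modes p e k)ᵀ 0 = Sum.elim (fun i => p i ^ k * e i) 0 := by
    ext (i | i) <;> simp [modes]
  rw [h, blockSign, Matrix.fromBlocks_mulVec]
  simp

theorem blockSign_mulVec_modes_one (p e : Fin N → ℂ) (k : ℤ) :
    blockSign *ᵥ (modes p e k)ᵀ 1 = -(modes p e k)ᵀ 1 := by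
  have h : (modes p e k)ᵀ 1 =
      Sum.elim (0 : Fin N → ℂ) (fun i => (-conj (p i)) ^ k) := by
    ext (i | i) <;> simp [modes]
  rw [h, blockSign, Matrix.fromBlocks_mulVec]
  ext (i | i) <;> simp [Matrix.neg_mulVec]

theorem dotProduct_tauMatrix_inv_mulVec_modes_zero (p ξ₀ : Fin N → ℂ) (x t z : ℝ) (j k : ℤ)
    (a : Fin 2) :
    star ((modes p (amp p ξ₀ x t z) j)ᵀ a) ⬝ᵥ
      (tauMatrix p ξ₀ 0 x t z)⁻¹ *ᵥ (modes p (amp p ξ₀ x t z) k)ᵀ 0 = mom p ξ₀ j k x t z a 0 := by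
  rw [tauMatrix_zero_inv, ← Matrix.mulVec_mulVec, blockSign_mulVec_modes_zero, mom, moment_apply]

theorem dotProduct_tauMatrix_inv_mulVec_modes_one (p ξ₀ : Fin N → ℂ) (x t z : ℝ) (j k : ℤ)
    (a : Fin 2) :
    star ((modes p (amp p ξ₀ x t z) j)ᵀ a) ⬝ᵥ
      (tauMatrix p ξ₀ 0 x t z)⁻¹ *ᵥ (modes p (amp p ξ₀ x t z) k)ᵀ 1 =
        -mom p ξ₀ j k x t z a 1 := by
  rw [tauMatrix_zero_inv, ← Matrix.mulVec_mulVec, blockSign_mulVec_modes_one, Matrix.mulVec_neg,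
    dotProduct_neg, mom, moment_apply]

theorem tauMatrix_zero_det_isUnit (hp : ∀ i j, p i + conj (p j) ≠ 0) (ξ₀ : Fin N → ℂ)
    (x t z : ℝ) : IsUnit (tauMatrix p ξ₀ 0 x t z).det :=
  (F_ne_zero hp ξ₀ x t z).isUnit

theorem u_eq (hp : ∀ i j, p i + conj (p j) ≠ 0) (ξ₀ : Fin N → ℂ) (z x t : ℝ) :
    u p ξ₀ z x t = 2 * mom p ξ₀ 0 0 x t z 0 1 := by
  have hF := F_ne_zero hp ξ₀ x t z
  have hc : (Sum.elim 0 psi1 : Fin N ⊕ Fin N → ℂ) = (modes p (amp p ξ₀ x t z) 0)ᵀ 1 := by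
    ext (i | i) <;> simp [modes, psi1]
  have hr : Sum.elim (psi2 p ξ₀ 0 x t z) 0 = -star ((modes p (amp p ξ₀ x t z) 0)ᵀ 0) := by
    ext (i | i) <;> simp [modes, psi2, amp, Complex.exp_conj]
  have hG : G p ξ₀ x t z = F p ξ₀ x t z * mom p ξ₀ 0 0 x t z 0 1 := by
    rw [G, rho, det_bordered, hc, hr, Matrix.vecMulVec_neg, sub_neg_eq_add,
      det_add_vecMulVec _ (tauMatrix_zero_det_isUnit hp ξ₀ x t z),
      dotProduct_tauMatrix_inv_mulVec_modes_one, F, tau]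
    ring
  rw [u, hG, mul_div_cancel_left₀ _ hF]

/-- The Gram block at level `-2` differs from the one at level `0` by two rank-one matrices. -/
theorem tauMatrix_neg_two (hp : ∀ i j, p i + conj (p j) ≠ 0) (ξ₀ : Fin N → ℂ) (x t z : ℝ) :
    tauMatrix p ξ₀ (-2) x t z = tauMatrix p ξ₀ 0 x t z
      + Matrix.vecMulVec (-(modes p (amp p ξ₀ x t z) (-1))ᵀ 0)
          (star ((modes p (amp p ξ₀ x t z) 0)ᵀ 0))
      + Matrix.vecMulVec ((modes p (amp p ξ₀ x t z) (-2))ᵀ 0)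
          (star ((modes p (amp p ξ₀ x t z) 1)ᵀ 0)) := by
  ext (i | i) (j | j)
  · have h1 := hp i j
    have h2 := pole_ne_zero hp i
    have h3 : conj (p j) ≠ 0 := by simpa using pole_ne_zero hp j
    simp [tauMatrix, m1, phi1, psi2, modes, Matrix.vecMulVec_apply, amp, ← Complex.exp_conj,
      zpow_neg]
    field_simp
    ring
  all_goals simp [tauMatrix, modes, Matrix.vecMulVec_apply]

theorem h_eq (hp : ∀ i j, p i + conj (p j) ≠ 0) (ξ₀ : Fin N → ℂ) (x t z : ℝ) :
    h p ξ₀ x t z = -F p ξ₀ x t z * ((1 - mom p ξ₀ 0 (-1) x t z 0 0) * mom p ξ₀ 0 (-2) x t z 1 0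
      + mom p ξ₀ 0 (-2) x t z 0 0 * mom p ξ₀ 0 (-1) x t z 1 0) := by
  have hc : Sum.elim (phi1 p ξ₀ (-2) x t z) 0 = (modes p (amp p ξ₀ x t z) (-2))ᵀ 0 := by
    ext (i | i) <;> simp [modes, phi1, amp]
  have hr : (Sum.elim 0 phi2 : Fin N ⊕ Fin N → ℂ) = -star ((modes p (amp p ξ₀ x t z) 0)ᵀ 1) := by
    ext (i | i) <;> simp [modes, phi2]
  have hu := tauMatrix_zero_det_isUnit hp ξ₀ x t z
  rw [h, sigma, det_bordered, hc, hr, Matrix.vecMulVec_neg, sub_neg_eq_add,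
    tauMatrix_neg_two hp, add_assoc _ (Matrix.vecMulVec _ _) (Matrix.vecMulVec _ _),
    ← Matrix.vecMulVec_add, det_add_two_vecMulVec _ hu, det_add_two_vecMulVec _ hu]
  simp only [Matrix.mulVec_neg, dotProduct_neg, add_dotProduct,
    dotProduct_tauMatrix_inv_mulVec_modes_zero]
  rw [F, tau]
  ring

end Dictionary

/-! ### The nonlinear Schrödinger equation -/

section Schrodinger

variable {N : ℕ} {p : Fin N → ℂ}

theorem proj_mul_apply_zero (K : Matrix (Fin 2) (Fin 2) ℂ) (b : Fin 2) :
    (proj * K) 0 b = K 0 b := by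
  rw [Matrix.mul_apply, Fin.sum_univ_two]
  simp [proj]

theorem proj_mul_apply_one (K : Matrix (Fin 2) (Fin 2) ℂ) (b : Fin 2) : (proj * K) 1 b = 0 := by
  rw [Matrix.mul_apply, Fin.sum_univ_two]
  simp [proj]

theorem mul_proj_apply_zero (K : Matrix (Fin 2) (Fin 2) ℂ) (a : Fin 2) :
    (K * proj) a 0 = K a 0 := by
  rw [Matrix.mul_apply, Fin.sum_univ_two]
  simp [proj]

theorem mul_proj_apply_one (K : Matrix (Fin 2) (Fin 2) ℂ) (a : Fin 2) : (K * proj) a 1 = 0 := by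
  rw [Matrix.mul_apply, Fin.sum_univ_two]
  simp [proj]

theorem mul_proj_mul_apply (K L : Matrix (Fin 2) (Fin 2) ℂ) (a b : Fin 2) :
    (K * proj * L) a b = K a 0 * L 0 b := by
  rw [Matrix.mul_apply, Fin.sum_univ_two, mul_proj_apply_zero, mul_proj_apply_one, zero_mul,
    add_zero]

/-- The nonlinear Schrödinger equation for the off-diagonal moment. All moments of higher order
cancel, up to the instance `Y₁₀ + Y₀₁ = Y₀₀²` of the Sylvester relation. -/
theorem schrodinger_mom (hp : ∀ i j, p i + conj (p j) ≠ 0) (ξ₀ : Fin N → ℂ) (x t z : ℝ) :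
    Complex.I * deriv (fun s => mom p ξ₀ 0 0 x s z 0 1) t
      + deriv (deriv fun y => mom p ξ₀ 0 0 y t z 0 1) x
      + 2 * mom p ξ₀ 0 0 x t z 1 0 * mom p ξ₀ 0 0 x t z 0 1 ^ 2 = 0 := by
  have hx := fun (j k : ℤ) (y : ℝ) (a b : Fin 2) => hasEntryDeriv_mom_x hp ξ₀ j k y t z a b
  have h1 : ∀ y, HasDerivAt (fun y => mom p ξ₀ 0 0 y t z 0 1)
      (mom p ξ₀ 1 0 y t z 0 1 - mom p ξ₀ 0 0 y t z 0 0 * mom p ξ₀ 0 0 y t z 0 1) y := fun y =>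
    (hx 0 0 y 0 1).congr_deriv (by
      simp [proj_mul_apply_zero, mul_proj_apply_one, mul_proj_mul_apply])
  have h2 : HasDerivAt (fun y => mom p ξ₀ 1 0 y t z 0 1)
      (mom p ξ₀ 2 0 x t z 0 1 - mom p ξ₀ 1 0 x t z 0 0 * mom p ξ₀ 0 0 x t z 0 1) x :=
    (hx 1 0 x 0 1).congr_deriv (by
      simp [proj_mul_apply_zero, mul_proj_apply_one, mul_proj_mul_apply])
  have h3 : HasDerivAt (fun y => mom p ξ₀ 0 0 y t z 0 0)
      (mom p ξ₀ 1 0 x t z 0 0 + mom p ξ₀ 0 1 x t z 0 0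
        - mom p ξ₀ 0 0 x t z 0 0 * mom p ξ₀ 0 0 x t z 0 0) x :=
    (hx 0 0 x 0 0).congr_deriv (by
      simp [proj_mul_apply_zero, mul_proj_apply_zero, mul_proj_mul_apply])
  have ht : HasDerivAt (fun s => mom p ξ₀ 0 0 x s z 0 1)
      (Complex.I * (mom p ξ₀ 2 0 x t z 0 1 + mom p ξ₀ 0 1 x t z 0 0 * mom p ξ₀ 0 0 x t z 0 1
        - mom p ξ₀ 0 0 x t z 0 0 * mom p ξ₀ 1 0 x t z 0 1)) t :=
    (hasEntryDeriv_mom_t hp ξ₀ 0 0 x t z 0 1).congr_deriv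
      (by
      simp [proj_mul_apply_zero, mul_proj_apply_one, mul_proj_mul_apply])
  have hS := congrFun (congrFun (mom_add_mom hp ξ₀ 0 0 x t z) 0) 0
  simp only [zero_add, Matrix.add_apply, Matrix.mul_apply, Fin.sum_univ_two] at hS
  rw [ht.deriv, funext fun y => (h1 y).deriv, (h2.fun_sub (h3.fun_mul (h1 x))).deriv, ← mul_assoc,
    Complex.I_mul_I]
  linear_combination (-2 * mom p ξ₀ 0 0 x t z 0 1) * hS

theorem contDiff_u (hp : ∀ i j, p i + conj (p j) ≠ 0) (ξ₀ : Fin N → ℂ) (z : ℝ) :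
    ContDiff ℝ ∞ fun q : ℝ × ℝ => u p ξ₀ z q.1 q.2 := by
  simp only [u_eq hp]
  exact contDiff_const.mul (mom_entrySmooth hp ξ₀ 0 0 z 0 1)

theorem schrodinger_u (hp : ∀ i j, p i + conj (p j) ≠ 0) (ξ₀ : Fin N → ℂ) (z x t : ℝ) :
    Complex.I * deriv (fun s : ℝ => u p ξ₀ z x s) t
      + iteratedDeriv 2 (fun y : ℝ => u p ξ₀ z y t) x
      + 1 / 2 * (‖u p ξ₀ z x t‖ : ℂ) ^ 2 * u p ξ₀ z x t = 0 := by
  have hn : (‖u p ξ₀ z x t‖ : ℂ) ^ 2 =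
      4 * (mom p ξ₀ 0 0 x t z 0 1 * mom p ξ₀ 0 0 x t z 1 0) := by
    rw [← Complex.mul_conj', u_eq hp, map_mul, conj_mom_apply]
    simp only [map_ofNat]
    ring
  rw [hn]
  have hd : deriv (fun y => 2 * mom p ξ₀ 0 0 y t z 0 1) =
      fun y => 2 * deriv (fun y => mom p ξ₀ 0 0 y t z 0 1) y :=
    funext fun y => deriv_const_mul_field 2
  simp only [u_eq hp, iteratedDeriv_succ, iteratedDeriv_zero, hd, deriv_const_mul_field]
  linear_combination 2 * schrodinger_mom hp ξ₀ x t z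

end Schrodinger

/-! ### The Frenet frame of a curve parametrized by arc length -/

section Frenet

theorem cross_apply_zero (v w : E3) : cross v w 0 = v 1 * w 2 - v 2 * w 1 := by
  simp [cross, cross_apply]

theorem cross_apply_one (v w : E3) : cross v w 1 = v 2 * w 0 - v 0 * w 2 := by
  simp [cross, cross_apply]

theorem cross_apply_two (v w : E3) : cross v w 2 = v 0 * w 1 - v 1 * w 0 := by
  simp [cross, cross_apply]

theorem cross_smul (v w : E3) (r : ℝ) : cross v (r • w) = r • cross v w := by
  simp [cross]

theorem inner_eq_sum (v w : E3) : inner ℝ v w = v 0 * w 0 + v 1 * w 1 + v 2 * w 2 := by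
  simp [PiLp.inner_apply, Fin.sum_univ_three, mul_comm]

theorem hasDerivAt_apply {f : ℝ → E3} {f' : E3} {x : ℝ} (hf : HasDerivAt f f' x) (i : Fin 3) :
    HasDerivAt (fun y => f y i) (f' i) x :=
  (EuclideanSpace.proj (𝕜 := ℝ) i).hasFDerivAt.comp_hasDerivAt x hf

theorem hasDerivAt_of_apply {f : ℝ → E3} {f' : E3} {x : ℝ}
    (hf : ∀ i, HasDerivAt (fun y => f y i) (f' i) x) : HasDerivAt f f' x := by
  rw [hasDerivAt_iff_hasFDerivAt, ← hasFDerivWithinAt_univ, hasFDerivWithinAt_euclidean]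
  intro i
  rw [hasFDerivWithinAt_univ]
  refine (hf i).hasFDerivAt.congr_fderiv ?_
  ext
  simp

theorem hasDerivAt_cross {f g : ℝ → E3} {f' g' : E3} {x : ℝ} (hf : HasDerivAt f f' x)
    (hg : HasDerivAt g g' x) :
    HasDerivAt (fun y => cross (f y) (g y)) (cross f' (g x) + cross (f x) g') x := by
  have hf := hasDerivAt_apply hf
  have hg := hasDerivAt_apply hg
  refine hasDerivAt_of_apply fun i => ?_
  fin_cases i
  · simp only [Fin.zero_eta, PiLp.add_apply, cross_apply_zero]
    exact (((hf 1).fun_mul (hg 2)).fun_sub ((hf 2).fun_mul (hg 1))).congr_deriv (by ring)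
  · simp only [Fin.mk_one, PiLp.add_apply, cross_apply_one]
    exact (((hf 2).fun_mul (hg 0)).fun_sub ((hf 0).fun_mul (hg 2))).congr_deriv (by ring)
  · simp only [Fin.reduceFinMk, PiLp.add_apply, cross_apply_two]
    exact (((hf 0).fun_mul (hg 1)).fun_sub ((hf 1).fun_mul (hg 0))).congr_deriv (by ring)

/-- A curve of unit vectors is orthogonal to its derivative. -/
theorem inner_eq_zero_of_norm_eq_one {f : ℝ → E3} {f' : E3} {x : ℝ} (hf : HasDerivAt f f' x)
    (h1 : ∀ᶠ y in nhds x, ‖f y‖ = 1) : inner ℝ (f x) f' = 0 := by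
  have h2 := (hf.norm_sq).unique (((hasDerivAt_const x (1 : ℝ))).congr_of_eventuallyEq
    (h1.mono fun y hy => by simp [hy]))
  linarith

/-- Two orthonormal vectors and their vector product, as columns, form a rotation. -/
theorem orthonormal_cross_mem_specialOrthogonalGroup {v w : E3} (hv : inner ℝ v v = (1 : ℝ))
    (hw : inner ℝ w w = (1 : ℝ)) (hvw : inner ℝ v w = (0 : ℝ)) :
    (Matrix.of fun i j => (![v, w, cross v w] j) i : Matrix (Fin 3) (Fin 3) ℝ) ∈
      Matrix.specialOrthogonalGroup (Fin 3) ℝ := by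
  rw [inner_eq_sum] at hv hw hvw
  -- Lagrange's identity
  have hL : (v 1 * w 2 - v 2 * w 1) ^ 2 + (v 2 * w 0 - v 0 * w 2) ^ 2
      + (v 0 * w 1 - v 1 * w 0) ^ 2 = 1 := by
    linear_combination (w 0 * w 0 + w 1 * w 1 + w 2 * w 2) * hv + hw
      - (v 0 * w 0 + v 1 * w 1 + v 2 * w 2) * hvw
  rw [Matrix.mem_specialOrthogonalGroup_iff, Matrix.mem_orthogonalGroup_iff']
  constructor
  · ext i j
    rw [Matrix.mul_apply, Fin.sum_univ_three]
    fin_cases i <;> fin_cases j <;>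
      simp [cross_apply_zero, cross_apply_one, cross_apply_two] <;> linarith
  · rw [Matrix.det_fin_three]
    simp [cross_apply_zero, cross_apply_one, cross_apply_two]
    linarith

/-- Expansion of a vector in the orthonormal basis `v`, `w`, `v × w`. -/
theorem eq_orthonormal_expansion {v w : E3} (hv : inner ℝ v v = (1 : ℝ))
    (hw : inner ℝ w w = (1 : ℝ)) (hvw : inner ℝ v w = (0 : ℝ)) (a : E3) :
    a = inner ℝ v a • v + inner ℝ w a • w + inner ℝ (cross v w) a • cross v w := by
  have h := (Matrix.mem_specialOrthogonalGroup_iff.mp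
    (orthonormal_cross_mem_specialOrthogonalGroup hv hw hvw)).1
  rw [Matrix.mem_orthogonalGroup_iff] at h
  have h1 := congrArg (fun K => K *ᵥ (WithLp.ofLp a)) h
  simp only [← Matrix.mulVec_mulVec, Matrix.one_mulVec] at h1
  ext i
  have h2 := congrFun h1 i
  rw [← h2]
  simp only [Matrix.mulVec, dotProduct, Fin.sum_univ_three, inner_eq_sum]
  simp
  ring

variable {c : ℝ → E3}

/-- The Frenet–Serret equations of a unit-speed curve at a point of nonvanishing curvature. -/
theorem frenet_serret (hc : ContDiff ℝ ∞ c) (h1 : ∀ y, ‖tangent c y‖ = 1) {x : ℝ}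
    (hκ : curvature c x ≠ 0) :
    frenetFrame c x ∈ Matrix.specialOrthogonalGroup (Fin 3) ℝ ∧
      HasDerivAt (tangent c) (curvature c x • normal c x) x ∧
      HasDerivAt (normal c)
        (-curvature c x • tangent c x + torsion c x • binormal c x) x ∧
      HasDerivAt (binormal c) (-torsion c x • normal c x) x := by
  have hT : ContDiff ℝ ∞ (deriv c) := (contDiff_infty_iff_deriv.mp hc).2
  have hA : ContDiff ℝ ∞ (deriv (deriv c)) := (contDiff_infty_iff_deriv.mp hT).2
  have hTd : ∀ y, HasDerivAt (tangent c) (deriv (deriv c) y) y := fun y =>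
    (hT.differentiable (by simp) y).hasDerivAt
  have hAd : DifferentiableAt ℝ (deriv (deriv c)) x := hA.differentiable (by simp) x
  have hκn : ∀ y, curvature c y ≠ 0 → deriv (deriv c) y = curvature c y • normal c y :=
    fun y hy => by rw [normal, smul_smul, mul_inv_cancel₀ hy, one_smul]
  have hne : deriv (deriv c) x ≠ 0 := norm_ne_zero_iff.mp hκ
  have hNd : HasDerivAt (normal c) (deriv (normal c) x) x :=
    DifferentiableAt.hasDerivAt (((hAd.norm ℝ hne).inv hκ).smul hAd)
  have hN1 : ∀ y, curvature c y ≠ 0 → ‖normal c y‖ = 1 := fun y hy => by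
    rw [normal, norm_smul, norm_inv, curvature, norm_norm]
    exact inv_mul_cancel₀ hy
  have hTN : ∀ y, inner ℝ (tangent c y) (normal c y) = (0 : ℝ) := fun y => by
    rw [normal, inner_smul_right,
      inner_eq_zero_of_norm_eq_one (hTd y) (Filter.Eventually.of_forall h1), mul_zero]
  have hTT : inner ℝ (tangent c x) (tangent c x) = (1 : ℝ) := by
    rw [real_inner_self_eq_norm_sq, h1, one_pow]
  have hNN : inner ℝ (normal c x) (normal c x) = (1 : ℝ) := by
    rw [real_inner_self_eq_norm_sq, hN1 x hκ, one_pow]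
  have hNN' : inner ℝ (normal c x) (deriv (normal c) x) = (0 : ℝ) :=
    inner_eq_zero_of_norm_eq_one hNd
      ((hA.continuous.norm.continuousAt.eventually_ne hκ).mono fun y hy => hN1 y hy)
  have hT' := hTd x
  rw [hκn x hκ] at hT'
  have hTN' : inner ℝ (tangent c x) (deriv (normal c) x) = -curvature c x := by
    have h2 := (hT'.inner ℝ hNd).unique
      ((hasDerivAt_const x (0 : ℝ)).congr_of_eventuallyEq (Filter.Eventually.of_forall hTN))
    rw [inner_smul_left, hNN] at h2
    simp at h2
    linarith
  have hB' := hasDerivAt_cross hT' hNd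
  have hBd : deriv (binormal c) x = cross (tangent c x) (deriv (normal c) x) := by
    refine hB'.deriv.trans ?_
    ext i
    fin_cases i <;> simp [cross_apply_zero, cross_apply_one, cross_apply_two] <;> ring
  have hBN' : inner ℝ (binormal c x) (deriv (normal c) x) = torsion c x := by
    rw [torsion, hBd, binormal, inner_eq_sum, inner_eq_sum]
    simp only [cross_apply_zero, cross_apply_one, cross_apply_two]
    ring
  have hN' := eq_orthonormal_expansion hTT hNN (hTN x) (deriv (normal c) x)
  rw [hTN', hNN', zero_smul, add_zero] at hN'
  change _ = _ + inner ℝ (binormal c x) _ • binormal c x at hN'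
  rw [hBN'] at hN'
  refine ⟨orthonormal_cross_mem_specialOrthogonalGroup hTT hNN (hTN x), hT', hN' ▸ hNd, ?_⟩
  have hB'' : deriv (binormal c) x = -torsion c x • normal c x := by
    have e1 := hTT
    have e2 := hTN x
    rw [inner_eq_sum] at e1 e2
    rw [hBd, hN', binormal]
    ext i
    fin_cases i <;> simp [cross_apply_zero, cross_apply_one, cross_apply_two]
    · linear_combination torsion c x * (tangent c x 0 * e2 - normal c x 0 * e1)
    · linear_combination torsion c x * (tangent c x 1 * e2 - normal c x 1 * e1)
    · linear_combination torsion c x * (tangent c x 2 * e2 - normal c x 2 * e1)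
  rw [← hB'']
  exact hB'.differentiableAt.hasDerivAt

theorem hasDerivAt_frenetFrame (hc : ContDiff ℝ ∞ c) (h1 : ∀ y, ‖tangent c y‖ = 1) {x : ℝ}
    (hκ : curvature c x ≠ 0) (i j : Fin 3) :
    HasDerivAt (fun y => frenetFrame c y i j) ((frenetFrame c x * frenetMatrix c x) i j) x := by
  obtain ⟨-, hT, hN, hB⟩ := frenet_serret hc h1 hκ
  rw [Matrix.mul_apply, Fin.sum_univ_three]
  fin_cases j
  · exact (hasDerivAt_apply hT i).congr_deriv (by simp [frenetFrame, frenetMatrix]; ring)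
  · exact (hasDerivAt_apply hN i).congr_deriv (by simp [frenetFrame, frenetMatrix]; ring)
  · exact (hasDerivAt_apply hB i).congr_deriv (by simp [frenetFrame, frenetMatrix]; ring)

end Frenet

/-! ### The dressing matrix and the curve -/

section Curve

variable {N : ℕ} {p : Fin N → ℂ}

/-- The dressing matrix `1 - Θᴴ M⁻¹ Λ⁻¹ Θ` at the spectral parameter `0`. It takes values in
`SU(2)`, and conjugation by it carries a fixed frame to a frame along the curve. -/
def dressing (p ξ₀ : Fin N → ℂ) (x t z : ℝ) : Matrix (Fin 2) (Fin 2) ℂ :=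
  1 - mom p ξ₀ 0 (-1) x t z

theorem dressing_unitary (hp : ∀ i j, p i + conj (p j) ≠ 0) (ξ₀ : Fin N → ℂ) (x t z : ℝ) :
    (dressing p ξ₀ x t z)ᴴ * dressing p ξ₀ x t z = 1 := by
  have h := mom_add_mom hp ξ₀ (-1) (-1) x t z
  simp only [neg_add_cancel] at h
  rw [dressing, Matrix.conjTranspose_sub, mom_conjTranspose, Matrix.conjTranspose_one,
    Matrix.sub_mul, Matrix.mul_sub, Matrix.mul_sub, ← h]
  simp

theorem dressing_det (hp : ∀ i j, p i + conj (p j) ≠ 0) (ξ₀ : Fin N → ℂ) (x t z : ℝ) :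
    (dressing p ξ₀ x t z).det = 1 := by
  set M := gram p (amp p ξ₀ x t z)
  set Θ := modes p (amp p ξ₀ x t z)
  have hM : M.det ≠ 0 := gram_det_ne_zero hp _
  have hstar : (poles p)ᴴ.det = (poles p).det := by
    simp only [poles, Matrix.diagonal_conjTranspose, Matrix.det_diagonal, Fintype.prod_sum_type,
      Pi.star_apply, Sum.elim_inl, Sum.elim_inr, ← Finset.prod_mul_distrib]
    exact Finset.prod_congr rfl fun i _ => by simp [mul_comm]
  have hpoles : (poles p).det ≠ 0 := by
    simp only [poles, Matrix.det_diagonal, Finset.prod_ne_zero_iff]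
    rintro (i | i) -
    · exact pole_ne_zero hp i
    · simpa using pole_ne_zero hp i
  have h1 : dressing p ξ₀ x t z = 1 - (Θ 0)ᴴ * (M⁻¹ * Θ (-1)) := by
    rw [dressing, mom, moment, Matrix.mul_assoc]
  have h2 : poles p * M * (1 - M⁻¹ * Θ (-1) * (Θ 0)ᴴ) = -(M * (poles p)ᴴ) := by
    have h3 : poles p * Θ (-1) = Θ 0 := poles_mul_modes hp _ (-1)
    rw [Matrix.mul_sub, Matrix.mul_one, ← Matrix.mul_assoc, ← Matrix.mul_assoc,
      Matrix.mul_nonsing_inv_cancel_right _ _ hM.isUnit, h3, ← gram_sylvester hp]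
    abel
  have h4 := congrArg Matrix.det h2
  rw [Matrix.det_neg, Matrix.det_mul, Matrix.det_mul, Matrix.det_mul, hstar, Fintype.card_sum,
    ← two_mul, pow_mul, neg_one_sq, one_pow, one_mul, mul_comm M.det] at h4
  rw [h1, Matrix.det_one_sub_mul_comm]
  exact mul_left_cancel₀ (mul_ne_zero hpoles hM) (h4.trans (mul_one _).symm)

theorem dressing_apply_one (hp : ∀ i j, p i + conj (p j) ≠ 0) (ξ₀ : Fin N → ℂ) (x t z : ℝ) :
    dressing p ξ₀ x t z 1 0 = -conj (dressing p ξ₀ x t z 0 1) ∧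
      dressing p ξ₀ x t z 1 1 = conj (dressing p ξ₀ x t z 0 0) := by
  have h : (dressing p ξ₀ x t z)ᴴ = (dressing p ξ₀ x t z).adjugate := by
    rw [← mul_one (dressing p ξ₀ x t z)ᴴ, ← one_smul ℂ (1 : Matrix (Fin 2) (Fin 2) ℂ),
      ← dressing_det hp ξ₀ x t z, ← Matrix.mul_adjugate, ← Matrix.mul_assoc,
      dressing_unitary hp, Matrix.one_mul]
  rw [Matrix.adjugate_fin_two] at h
  have h0 := congrFun (congrFun h 0) 0
  have h1 := congrFun (congrFun h 1) 0
  simp only [Matrix.conjTranspose_apply, Matrix.of_apply, Matrix.cons_val] at h0 h1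
  exact ⟨by rw [starRingEnd_apply, h1, neg_neg], by rw [starRingEnd_apply, h0]⟩

/-- The unit length of the first row of the dressing matrix. -/
theorem dressing_row (hp : ∀ i j, p i + conj (p j) ≠ 0) (ξ₀ : Fin N → ℂ) (x t z : ℝ) :
    dressing p ξ₀ x t z 0 0 * conj (dressing p ξ₀ x t z 0 0)
      + dressing p ξ₀ x t z 0 1 * conj (dressing p ξ₀ x t z 0 1) = 1 := by
  have h := dressing_det hp ξ₀ x t z
  rw [Matrix.det_fin_two, (dressing_apply_one hp ξ₀ x t z).1,
    (dressing_apply_one hp ξ₀ x t z).2] at h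
  linear_combination h

theorem mom_zero_neg_one (p ξ₀ : Fin N → ℂ) (x t z : ℝ) :
    mom p ξ₀ 0 (-1) x t z = 1 - dressing p ξ₀ x t z := by
  rw [dressing, sub_sub_cancel]

theorem mom_neg_one_zero (p ξ₀ : Fin N → ℂ) (x t z : ℝ) :
    mom p ξ₀ (-1) 0 x t z = 1 - (dressing p ξ₀ x t z)ᴴ := by
  rw [dressing, Matrix.conjTranspose_sub, mom_conjTranspose, Matrix.conjTranspose_one,
    sub_sub_cancel]

theorem mom_one_neg_one (hp : ∀ i j, p i + conj (p j) ≠ 0) (ξ₀ : Fin N → ℂ) (x t z : ℝ) :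
    mom p ξ₀ 1 (-1) x t z = -(mom p ξ₀ 0 0 x t z * dressing p ξ₀ x t z) := by
  have h := mom_add_mom hp ξ₀ 0 (-1) x t z
  simp only [neg_add_cancel, zero_add] at h
  rw [dressing, Matrix.mul_sub, ← h, Matrix.mul_one]
  abel

theorem mom_one_neg_one_apply_zero (hp : ∀ i j, p i + conj (p j) ≠ 0) (ξ₀ : Fin N → ℂ)
    (x t z : ℝ) (b : Fin 2) :
    mom p ξ₀ 1 (-1) x t z 0 b = -(mom p ξ₀ 0 0 x t z 0 0 * dressing p ξ₀ x t z 0 b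
      + mom p ξ₀ 0 0 x t z 0 1 * dressing p ξ₀ x t z 1 b) := by
  rw [mom_one_neg_one hp, Matrix.neg_apply, Matrix.mul_apply, Fin.sum_univ_two]

/-- The quotient `h / F` is an entry of the Hermitian matrix `Θᴴ Λ⁻ᴴ M⁻¹ Λ⁻¹ Θ`. -/
theorem h_eq_F_mul (hp : ∀ i j, p i + conj (p j) ≠ 0) (ξ₀ : Fin N → ℂ) (x t z : ℝ) :
    h p ξ₀ x t z = F p ξ₀ x t z * mom p ξ₀ (-1) (-1) x t z 1 0 := by
  have hS := congrFun (congrFun (mom_add_mom hp ξ₀ (-1) (-2) x t z) 1) 0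
  have e1 : (-2 : ℤ) + 1 = -1 := rfl
  simp only [neg_add_cancel, e1, Matrix.add_apply, Matrix.mul_apply, Fin.sum_univ_two] at hS
  obtain ⟨hU0, hU1⟩ := dressing_apply_one hp ξ₀ x t z
  rw [h_eq hp, mom_zero_neg_one]
  rw [mom_neg_one_zero] at hS
  simp only [Matrix.sub_apply, Matrix.conjTranspose_apply, Matrix.one_apply_eq, ne_eq,
    one_ne_zero, not_false_eq_true, Matrix.one_apply_ne, ← starRingEnd_apply] at hS ⊢
  rw [hU1, Complex.conj_conj] at hS
  rw [hU0]
  linear_combination (-F p ξ₀ x t z) * hS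

theorem curveExpr_eq (hp : ∀ i j, p i + conj (p j) ≠ 0) (ξ₀ : Fin N → ℂ) (z x t : ℝ) :
    curveExpr p ξ₀ z x t =
      ![((2 * (mom p ξ₀ (-1) (-1) x t z 1 0).re : ℝ) : ℂ),
        ((2 * (mom p ξ₀ (-1) (-1) x t z 1 0).im : ℝ) : ℂ),
        ((2 * (mom p ξ₀ (-1) (-1) x t z 0 0).re - x : ℝ) : ℂ)] := by
  have hF := F_ne_zero hp ξ₀ x t z
  have hFc : conj (F p ξ₀ x t z) = F p ξ₀ x t z :=
    Complex.conj_eq_iff_im.mpr (F_pos hp ξ₀ x t z).2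
  have hW : ((mom p ξ₀ (-1) (-1) x t z 0 0).re : ℂ) = mom p ξ₀ (-1) (-1) x t z 0 0 :=
    Complex.conj_eq_iff_re.mp (conj_mom_apply p ξ₀ _ _ x t z 0 0)
  rw [curveExpr, h_eq_F_mul hp, map_mul, hFc, ← mul_add, ← mul_sub, mul_div_cancel_left₀ _ hF,
    mul_div_cancel_left₀ _ hF, deriv_log_F hp, Complex.add_conj, Complex.sub_conj]
  congr 2
  · push_cast
    field_simp
  · push_cast
    rw [hW]

theorem curve_eq (hp : ∀ i j, p i + conj (p j) ≠ 0) (ξ₀ : Fin N → ℂ) (z x t : ℝ) :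
    curve p ξ₀ z x t =
      !₂[2 * (mom p ξ₀ (-1) (-1) x t z 1 0).re, 2 * (mom p ξ₀ (-1) (-1) x t z 1 0).im,
        2 * (mom p ξ₀ (-1) (-1) x t z 0 0).re - x] := by
  ext i
  fin_cases i <;> simp [curve, curveExpr_eq hp]

theorem contDiff_curve (hp : ∀ i j, p i + conj (p j) ≠ 0) (ξ₀ : Fin N → ℂ) (z : ℝ) :
    ContDiff ℝ ∞ fun q : ℝ × ℝ => curve p ξ₀ z q.1 q.2 := by
  have hW := mom_entrySmooth hp ξ₀ (-1) (-1) z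
  simp only [curve_eq hp]
  rw [contDiff_euclidean]
  intro i
  fin_cases i
  · exact contDiff_const.mul ((Complex.reCLM.contDiff (n := ∞)).comp (hW 1 0))
  · exact contDiff_const.mul ((Complex.imCLM.contDiff (n := ∞)).comp (hW 1 0))
  · exact (contDiff_const.mul ((Complex.reCLM.contDiff (n := ∞)).comp (hW 0 0))).sub contDiff_fst

theorem contDiff_section {f : ℝ → ℝ → E3} (hf : ContDiff ℝ ∞ fun q : ℝ × ℝ => f q.1 q.2)
    (t : ℝ) : ContDiff ℝ ∞ fun y => f y t := by
  have hpair : ContDiff ℝ ∞ fun y : ℝ => (y, t) := contDiff_id.prodMk contDiff_const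
  exact hf.comp hpair

theorem contDiff_curve_x (hp : ∀ i j, p i + conj (p j) ≠ 0) (ξ₀ : Fin N → ℂ) (z t : ℝ) :
    ContDiff ℝ ∞ fun y => curve p ξ₀ z y t :=
  contDiff_section (f := curve p ξ₀ z) (contDiff_curve hp ξ₀ z) t

theorem hasDerivAt_re {f : ℝ → ℂ} {f' : ℂ} {x : ℝ} (hf : HasDerivAt f f' x) :
    HasDerivAt (fun y => (f y).re) f'.re x :=
  Complex.reCLM.hasFDerivAt.comp_hasDerivAt x hf

theorem hasDerivAt_im {f : ℝ → ℂ} {f' : ℂ} {x : ℝ} (hf : HasDerivAt f f' x) :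
    HasDerivAt (fun y => (f y).im) f'.im x :=
  Complex.imCLM.hasFDerivAt.comp_hasDerivAt x hf

/-- The unit vector determined by the first row `(α, β)` of a matrix `U` in `SU(2)`: the image of
`1 - 2 Uᴴ E U`, with `E` the projection onto the first coordinate, under the identification of a
traceless Hermitian matrix `A` with the vector `(Re A₁₀, Im A₁₀, A₀₀)`. -/
def hopfVector (α β : ℂ) : E3 :=
  !₂[-2 * (conj β * α).re, -2 * (conj β * α).im, 1 - 2 * (conj α * α).re]

theorem norm_hopfVector {α β : ℂ} (h : α * conj α + β * conj β = 1) : ‖hopfVector α β‖ = 1 := by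
  have h1 := congrArg Complex.re h
  simp at h1
  rw [← sq_eq_sq₀ (norm_nonneg _) zero_le_one, one_pow, ← real_inner_self_eq_norm_sq,
    inner_eq_sum]
  simp [hopfVector]
  linear_combination (4 * (α.re * α.re + α.im * α.im)) * h1

theorem hasDerivAt_curve_x (hp : ∀ i j, p i + conj (p j) ≠ 0) (ξ₀ : Fin N → ℂ) (z x t : ℝ) :
    HasDerivAt (fun y => curve p ξ₀ z y t)
      (hopfVector (dressing p ξ₀ x t z 0 0) (dressing p ξ₀ x t z 0 1)) x := by
  have hW := hasEntryDeriv_mom_x hp ξ₀ (-1) (-1) x t z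
  have hW10 := hW 1 0
  have hW00 := hW 0 0
  simp only [neg_add_cancel, Matrix.add_apply, Matrix.sub_apply, proj_mul_apply_zero,
    proj_mul_apply_one, mul_proj_apply_zero, mul_proj_mul_apply, mom_zero_neg_one,
    mom_neg_one_zero, Matrix.conjTranspose_apply, Matrix.one_apply_eq, ne_eq, one_ne_zero,
    not_false_eq_true, Matrix.one_apply_ne, ← starRingEnd_apply] at hW10 hW00
  simp only [curve_eq hp]
  refine hasDerivAt_of_apply fun i => ?_
  fin_cases i
  · refine ((hasDerivAt_re hW10).const_mul 2).congr_deriv ?_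
    simp [hopfVector]
    ring
  · refine ((hasDerivAt_im hW10).const_mul 2).congr_deriv ?_
    simp [hopfVector]
    ring
  · refine (((hasDerivAt_re hW00).const_mul 2).sub (hasDerivAt_id x)).congr_deriv ?_
    simp [hopfVector]
    ring

/-- The dressing matrix satisfies `U' = [E, X] U`, where `E` is the projection onto the first
coordinate and `X` the moment at level zero; these are the two entries of the first row. -/
theorem hasDerivAt_dressing (hp : ∀ i j, p i + conj (p j) ≠ 0) (ξ₀ : Fin N → ℂ) (x t z : ℝ) :
    HasDerivAt (fun y => dressing p ξ₀ y t z 0 0)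
      (-(mom p ξ₀ 0 0 x t z 0 1 * conj (dressing p ξ₀ x t z 0 1))) x ∧
    HasDerivAt (fun y => dressing p ξ₀ y t z 0 1)
      (mom p ξ₀ 0 0 x t z 0 1 * conj (dressing p ξ₀ x t z 0 0)) x := by
  have hX := hasEntryDeriv_mom_x hp ξ₀ 0 (-1) x t z
  obtain ⟨hU0, hU1⟩ := dressing_apply_one hp ξ₀ x t z
  constructor
  · refine ((hX 0 0).const_sub 1).congr_deriv ?_
    simp only [neg_add_cancel, zero_add, Matrix.add_apply, Matrix.sub_apply, proj_mul_apply_zero,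
      mul_proj_apply_zero, mul_proj_mul_apply, mom_one_neg_one_apply_zero hp,
      mom_zero_neg_one,
      Matrix.one_apply_eq, hU0]
    ring
  · refine ((hX 0 1).const_sub 0).congr_deriv ?_
    simp only [neg_add_cancel, zero_add, Matrix.add_apply, Matrix.sub_apply, proj_mul_apply_zero,
      mul_proj_apply_one, mul_proj_mul_apply, mom_one_neg_one_apply_zero hp,
      mom_zero_neg_one, ne_eq, zero_ne_one,
      not_false_eq_true, Matrix.one_apply_ne, hU1]
    ring

theorem hasDerivAt_hopfVector {α β : ℝ → ℂ} {α' β' : ℂ} {x : ℝ} (hα : HasDerivAt α α' x)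
    (hβ : HasDerivAt β β' x) :
    HasDerivAt (fun y => hopfVector (α y) (β y))
      !₂[-2 * (conj β' * α x + conj (β x) * α').re, -2 * (conj β' * α x + conj (β x) * α').im,
        -(2 * (conj α' * α x + conj (α x) * α').re)] x := by
  have h1 := hβ.star.fun_mul hα
  have h2 := hα.star.fun_mul hα
  refine hasDerivAt_of_apply fun i => ?_
  fin_cases i
  · exact (hasDerivAt_re h1).const_mul (-2)
  · exact (hasDerivAt_im h1).const_mul (-2)
  · exact ((hasDerivAt_re h2).const_mul 2).const_sub 1

/-- The velocity of the curve: the entries of `2 i Uᴴ [X, E] U`, in terms of the first row `(α, β)`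
of the dressing matrix `U` and of the off-diagonal entry `q` of the moment `X` at level zero. -/
theorem hasDerivAt_curve_t (hp : ∀ i j, p i + conj (p j) ≠ 0) (ξ₀ : Fin N → ℂ) (z x t : ℝ)
    {q α β : ℂ} (hq : mom p ξ₀ 0 0 x t z 0 1 = q) (hα : dressing p ξ₀ x t z 0 0 = α)
    (hβ : dressing p ξ₀ x t z 0 1 = β) :
    HasDerivAt (fun s => curve p ξ₀ z x s)
      !₂[2 * (Complex.I * (conj q * α ^ 2 + q * conj β ^ 2)).re,
        2 * (Complex.I * (conj q * α ^ 2 + q * conj β ^ 2)).im,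
        2 * (Complex.I * (q * conj α * conj β - conj q * α * β)).re] t := by
  have hW := hasEntryDeriv_mom_t hp ξ₀ (-1) (-1) x t z
  obtain ⟨hU0, hU1⟩ := dressing_apply_one hp ξ₀ x t z
  have hr : ∀ b, mom p ξ₀ (-1) 1 x t z b 0 = conj (mom p ξ₀ 1 (-1) x t z 0 b) := fun b =>
    (conj_mom_apply p ξ₀ 1 (-1) x t z 0 b).symm
  have ha : conj (mom p ξ₀ 0 0 x t z 0 0) = mom p ξ₀ 0 0 x t z 0 0 := conj_mom_apply ..
  have e1 : (-1 : ℤ) + 2 = 1 := rfl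
  have hW10 := hW 1 0
  have hW00 := hW 0 0
  simp only [e1, Matrix.add_apply, Matrix.sub_apply, Matrix.smul_apply, smul_eq_mul,
    proj_mul_apply_zero, proj_mul_apply_one, mul_proj_apply_zero, mul_proj_mul_apply, hr,
    mom_one_neg_one_apply_zero hp, mom_zero_neg_one,
    mom_neg_one_zero, Matrix.conjTranspose_apply, Matrix.one_apply_eq, ne_eq, one_ne_zero,
    not_false_eq_true, Matrix.one_apply_ne, ← starRingEnd_apply, hU0, hU1, hq, hα, hβ, map_neg,
    map_add, map_mul, Complex.conj_conj, ha] at hW10 hW00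
  simp only [curve_eq hp]
  refine hasDerivAt_of_apply fun i => ?_
  fin_cases i
  · refine ((hasDerivAt_re hW10).const_mul 2).congr_deriv (congrArg (fun w : ℂ => 2 * w.re) ?_)
    ring
  · refine ((hasDerivAt_im hW10).const_mul 2).congr_deriv (congrArg (fun w : ℂ => 2 * w.im) ?_)
    ring
  · refine (((hasDerivAt_re hW00).const_mul 2).sub_const x).congr_deriv
      (congrArg (fun w : ℂ => 2 * w.re) ?_)
    ring

theorem deriv_curve_x (hp : ∀ i j, p i + conj (p j) ≠ 0) (ξ₀ : Fin N → ℂ) (z t : ℝ) :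
    deriv (fun y => curve p ξ₀ z y t) =
      fun y => hopfVector (dressing p ξ₀ y t z 0 0) (dressing p ξ₀ y t z 0 1) :=
  funext fun y => (hasDerivAt_curve_x hp ξ₀ z y t).deriv

theorem norm_tangent_curve (hp : ∀ i j, p i + conj (p j) ≠ 0) (ξ₀ : Fin N → ℂ) (z x t : ℝ) :
    ‖tangent (fun y => curve p ξ₀ z y t) x‖ = 1 := by
  rw [tangent, deriv_curve_x hp]
  exact norm_hopfVector (dressing_row hp ξ₀ x t z)

/-- The local induction equation. -/
theorem local_induction_curve (hp : ∀ i j, p i + conj (p j) ≠ 0) (ξ₀ : Fin N → ℂ) (z x t : ℝ) :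
    deriv (fun s => curve p ξ₀ z x s) t =
      cross (deriv (fun y => curve p ξ₀ z y t) x)
        (deriv (deriv fun y => curve p ξ₀ z y t) x) := by
  obtain ⟨hα, hβ⟩ := hasDerivAt_dressing hp ξ₀ x t z
  have hrow := congrArg Complex.re (dressing_row hp ξ₀ x t z)
  rw [(hasDerivAt_curve_t hp ξ₀ z x t rfl rfl rfl).deriv, deriv_curve_x hp,
    (hasDerivAt_hopfVector hα hβ).deriv]
  beta_reduce
  generalize dressing p ξ₀ x t z 0 0 = α at *
  generalize dressing p ξ₀ x t z 0 1 = β at *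
  generalize mom p ξ₀ 0 0 x t z 0 1 = q at *
  obtain ⟨a, b⟩ := α
  obtain ⟨c, d⟩ := β
  obtain ⟨r, s⟩ := q
  simp at hrow
  -- Each coordinate holds up to a multiple of `|α|² + |β|² - 1`. The multipliers come from making
  -- the third coordinate `1 - 2 |α|²` of the tangent homogeneous, and are real or imaginary parts
  -- of `4 q* α²` and of `4 q α* β*`, up to sign.
  ext i
  fin_cases i
  · simp [hopfVector, cross_apply_zero, pow_two]
    linear_combination (4 * (2 * a * b * r - s * (a ^ 2 - b ^ 2))) * hrow
  · simp [hopfVector, cross_apply_one, pow_two]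
    linear_combination (-4 * (r * (a ^ 2 - b ^ 2) + 2 * a * b * s)) * hrow
  · simp [hopfVector, cross_apply_two, pow_two]
    linear_combination (4 * (s * (a * c - b * d) - r * (a * d + b * c))) * hrow

end Curve

end NLSFlow

end

theorem theorem2 (N : ℕ) (p ξ₀ : Fin N → ℂ)
    (hp : ∀ i j, p i + (starRingEnd ℂ) (p j) ≠ 0) :
    -- `F` is a smooth function with positive real values, so the expressions below make sense
    (ContDiff ℝ ∞ (fun q : ℝ × ℝ × ℝ => NLSFlow.F p ξ₀ q.1 q.2.1 q.2.2) ∧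
      ∀ x t z : ℝ, 0 < (NLSFlow.F p ξ₀ x t z).re ∧ (NLSFlow.F p ξ₀ x t z).im = 0) ∧
    ∀ z : ℝ,
      -- (1) `u` is smooth and satisfies NLS
      (ContDiff ℝ ∞ (fun q : ℝ × ℝ => NLSFlow.u p ξ₀ z q.1 q.2) ∧
        ∀ x t : ℝ,
          Complex.I * deriv (fun s : ℝ => NLSFlow.u p ξ₀ z x s) t
            + iteratedDeriv 2 (fun y : ℝ => NLSFlow.u p ξ₀ z y t) x
            + 1 / 2 * (‖NLSFlow.u p ξ₀ z x t‖ : ℂ) ^ 2 * NLSFlow.u p ξ₀ z x t = 0) ∧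
      -- (2) `γ` is a smooth real curve, parametrized by arc length, moving by LIE
      (∀ (x t : ℝ) (i : Fin 3), (NLSFlow.curveExpr p ξ₀ z x t i).im = 0) ∧
      ContDiff ℝ ∞ (fun q : ℝ × ℝ => NLSFlow.curve p ξ₀ z q.1 q.2) ∧
      ∀ x t : ℝ,
        ‖NLSFlow.tangent (fun y => NLSFlow.curve p ξ₀ z y t) x‖ = 1 ∧
        deriv (fun s => NLSFlow.curve p ξ₀ z x s) t =
          NLSFlow.cross (deriv (fun y => NLSFlow.curve p ξ₀ z y t) x)
            (iteratedDeriv 2 (fun y => NLSFlow.curve p ξ₀ z y t) x) ∧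
        -- where the curvature does not vanish, so that the Frenet frame exists:
        -- the frame is in SO(3), the Frenet–Serret formula holds, and `γ` moves by `∂γ/∂t = κ B`
        (NLSFlow.curvature (fun y => NLSFlow.curve p ξ₀ z y t) x ≠ 0 →
          NLSFlow.frenetFrame (fun y => NLSFlow.curve p ξ₀ z y t) x ∈
            Matrix.specialOrthogonalGroup (Fin 3) ℝ ∧
          (∀ i j : Fin 3,
            HasDerivAt
              (fun y => NLSFlow.frenetFrame (fun w => NLSFlow.curve p ξ₀ z w t) y i j)
              ((NLSFlow.frenetFrame (fun y => NLSFlow.curve p ξ₀ z y t) x *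
                NLSFlow.frenetMatrix (fun y => NLSFlow.curve p ξ₀ z y t) x) i j) x) ∧
          deriv (fun s => NLSFlow.curve p ξ₀ z x s) t =
            NLSFlow.curvature (fun y => NLSFlow.curve p ξ₀ z y t) x •
              NLSFlow.binormal (fun y => NLSFlow.curve p ξ₀ z y t) x) := by
  refine ⟨⟨NLSFlow.contDiff_F p ξ₀, NLSFlow.F_pos hp ξ₀⟩, fun z =>
    ⟨⟨NLSFlow.contDiff_u hp ξ₀ z, NLSFlow.schrodinger_u hp ξ₀ z⟩, ?_,
      NLSFlow.contDiff_curve hp ξ₀ z, fun x t => ?_⟩⟩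
  · intro x t i
    rw [NLSFlow.curveExpr_eq hp]
    fin_cases i <;> exact Complex.ofReal_im _
  · have hc : ContDiff ℝ ∞ fun y => NLSFlow.curve p ξ₀ z y t :=
      NLSFlow.contDiff_curve_x hp ξ₀ z t
    have h1 := fun y => NLSFlow.norm_tangent_curve hp ξ₀ z y t
    have hL := NLSFlow.local_induction_curve hp ξ₀ z x t
    refine ⟨h1 x, ?_, fun hκ => ⟨(NLSFlow.frenet_serret hc h1 hκ).1,
      NLSFlow.hasDerivAt_frenetFrame hc h1 hκ, ?_⟩⟩
    · rw [hL, iteratedDeriv_succ, iteratedDeriv_one]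
    · rw [hL, NLSFlow.binormal, ← NLSFlow.cross_smul, NLSFlow.normal, smul_smul,
        mul_inv_cancel₀ hκ, one_smul, NLSFlow.tangent]
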